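/- Let $q\in(0,1)$ and $\zeta_-<0<\zeta_+$. Write $(z;q)_\infty=\prod_{i\ge 0}(1-zq^i)$, $\theta_q(z)=(z;q)_\infty(q/z;q)_\infty$ for $z\in\mathbb{C}\setminus\{0\}$, and $\theta_q(z_1,\dots,z_m)=\prod_i\theta_q(z_i)$, $(z_1,\dots,z_m;q)_\infty=\prod_i(z_i;q)_\infty$. Let $(\gamma,\delta)\in\mathbb{C}^2$ be an admissible pair, i.e. either $\delta=\overline{\gamma}\in\mathbb{C}\setminus\mathbb{R}$, or $\gamma,\delta$ are real and both lie in one interval $(\zeta_-^{-1}q^{m},\zeta_-^{-1}q^{m+1})$ or $(\zeta_+^{-1}q^{m+1},\zeta_+^{-1}q^{m})$ with $m\in\mathbb{Z}$. For $x,y$ in the lattice $\zeta_-q^{\mathbb{Z}}\sqcup\zeta_+q^{\mathbb{Z}}$ and $\gamma\ne\delta$ put $$K^{\gamma,\delta}(x,y)=C\,\frac{P(x)Q(y)-Q(x)P(y)}{x-y}\ (x\neq y),\qquad K^{\gamma,\delta}(x,x)=C\,\bigl(P'(x)Q(x)-Q'(x)P(x)\bigr),$$ $$P(x)=\sqrt{|x|}\,\frac{\theta_q(x\delta)}{\sqrt{\theta_q(x\gamma,x\delta)}},\qquad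 Q(x)=\sqrt{|x|}\,\frac{\theta_q(x\gamma)}{\sqrt{\theta_q(x\gamma,x\delta)}},$$ $$C=\frac{\theta_q(\gamma\zeta_-,\gamma\zeta_+,\delta\zeta_-,\delta\zeta_+)}{\zeta_+\,\theta_q(\zeta_- /\zeta_+,\gamma\delta\zeta_-\zeta_+)}\cdot\frac{\delta-\gamma}{\gamma\delta\,(\delta/\gamma,\gamma/\delta,q,q;q)_\infty},$$ where the derivatives are taken in the real variable $x$, and let $K^{\gamma,\gamma}(x,y)=\lim_{d\to\gamma}K^{\gamma,d}(x,y)$, the limit being over $d\ne\gamma$ such that $(\gamma,d)$ is admissible. All square roots here and below are the positive square roots of positive real numbers. Let $\epsilon(\zeta_+q^m)=1$, $\epsilon(\zeta_-q^m)=(-1)^m$, $\widetilde K^{\gamma,\delta}(x,y)=\epsilon(x)\epsilon(y)^{-1}K^{\gamma,\delta}(x,y)$, and for $\eta\in\mathbb{R}$ and $\epsilon_1,\epsilon_2\in\{+,-\}$ let $$\widehat{\mathfrak K}_{\epsilon_1,\epsilon_2}(\eta)=\sum_{m\in\mathbb{Z}}e^{i\eta m}\,\widetilde K^{\gamma,\delta}(\zeta_{\epsilon_1}q^m,\zeta_{\epsilon_2}).$$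 Then, for every $\eta\in\mathbb{R}$, these four series converge absolutely, and $$\widehat{\mathfrak K}_{+,+}(\eta)=\frac{q\,\theta_q(\gamma\zeta_-,\delta\zeta_-)}{\gamma\delta\zeta_+^2\,\theta_q(\zeta_- /\zeta_+,\gamma\delta\zeta_-\zeta_+)}\cdot\frac{\theta_q(-e^{i\eta}\zeta_+\sqrt{\gamma\delta/q},\,-e^{-i\eta}\zeta_+\sqrt{\gamma\delta/q})}{\theta_q(-e^{i\eta}\sqrt{q\gamma\delta}/\gamma,\,-e^{i\eta}\sqrt{q\gamma\delta}/\delta)},$$ $$\widehat{\mathfrak K}_{+,-}(\eta)=-\frac{q\sqrt{\theta_q(\gamma\zeta_-,\delta\zeta_-,\gamma\zeta_+,\delta\zeta_+)}}{\gamma\delta\zeta_+\sqrt{|\zeta_-\zeta_+|}\,\theta_q(\zeta_- /\zeta_+,\gamma\delta\zeta_-\zeta_+)}\cdot\frac{\theta_q(-e^{i\eta}\zeta_+\sqrt{\gamma\delta/q},\,-e^{-i\eta}\zeta_-\sqrt{\gamma\delta/q})}{\theta_q(-e^{i\eta}\sqrt{q\gamma\delta}/\gamma,\,-e^{i\eta}\sqrt{q\gamma\delta}/\delta)},$$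 $$\widehat{\mathfrak K}_{-,+}(\eta)=-\frac{q\sqrt{\theta_q(\gamma\zeta_-,\delta\zeta_-,\gamma\zeta_+,\delta\zeta_+)}}{\gamma\delta\zeta_+\sqrt{|\zeta_-\zeta_+|}\,\theta_q(\zeta_- /\zeta_+,\gamma\delta\zeta_-\zeta_+)}\cdot\frac{\theta_q(-e^{i\eta}\zeta_-\sqrt{\gamma\delta/q},\,-e^{-i\eta}\zeta_+\sqrt{\gamma\delta/q})}{\theta_q(-e^{i\eta}\sqrt{q\gamma\delta}/\gamma,\,-e^{i\eta}\sqrt{q\gamma\delta}/\delta)},$$ $$\widehat{\mathfrak K}_{-,-}(\eta)=\frac{q\,\theta_q(\gamma\zeta_+,\delta\zeta_+)}{\gamma\delta|\zeta_-\zeta_+|\,\theta_q(\zeta_- /\zeta_+,\gamma\delta\zeta_-\zeta_+)}\cdot\frac{\theta_q(-e^{i\eta}\zeta_-\sqrt{\gamma\delta/q},\,-e^{-i\eta}\zeta_-\sqrt{\gamma\delta/q})}{\theta_q(-e^{i\eta}\sqrt{q\gamma\delta}/\gamma,\,-e^{i\eta}\sqrt{q\gamma\delta}/\delta)}.$$ 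-/

import Mathlib

open Filter Topology

noncomputable section

namespace EllipticTail

/-- The infinite `q`-Pochhammer symbol `(z; q)_∞ = ∏_{i ≥ 0} (1 - z q^i)`. -/
def qPoch (q : ℝ) (z : ℂ) : ℂ := ∏' i : ℕ, (1 - z * (q : ℂ) ^ i)

/-- `(z₁, …, z_m; q)_∞ = (z₁; q)_∞ ⋯ (z_m; q)_∞`. -/
def qPochs (q : ℝ) (l : List ℂ) : ℂ := (l.map (qPoch q)).prod

/-- The theta function `θ_q(z) = (z; q)_∞ (q / z; q)_∞`, used for `z ≠ 0`. -/
def theta (q : ℝ) (z : ℂ) : ℂ := qPoch q z * qPoch q ((q : ℂ) / z)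

/-- `θ_q(z₁, …, z_m) = θ_q(z₁) ⋯ θ_q(z_m)`. -/
def thetas (q : ℝ) (l : List ℂ) : ℂ := (l.map (theta q)).prod

/-- The nonnegative square root of a complex number that is a nonnegative real
(it is only used for such numbers). -/
def posSqrt (z : ℂ) : ℂ := ((Real.sqrt z.re : ℝ) : ℂ)

/-- Admissible pairs: the principal series, or one of the two complementary series. -/
def IsAdmissiblePair (q ζp ζm : ℝ) (x y : ℂ) : Prop :=
  (x.im ≠ 0 ∧ y = (starRingEnd ℂ) x) ∨
  (∃ a b : ℝ, x = (a : ℂ) ∧ y = (b : ℂ) ∧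
    ((∃ m : ℤ, (ζm⁻¹ * q ^ m < a ∧ a < ζm⁻¹ * q ^ (m + 1)) ∧
        (ζm⁻¹ * q ^ m < b ∧ b < ζm⁻¹ * q ^ (m + 1))) ∨
     (∃ n : ℤ, (ζp⁻¹ * q ^ (n + 1) < a ∧ a < ζp⁻¹ * q ^ n) ∧
        (ζp⁻¹ * q ^ (n + 1) < b ∧ b < ζp⁻¹ * q ^ n))))

/-- The constant `C(γ, δ)`, for `γ ≠ δ`. -/
def constC (q ζp ζm : ℝ) (γ δ : ℂ) : ℂ :=
  thetas q [γ * ζm, γ * ζp, δ * ζm, δ * ζp] /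
      (ζp * thetas q [(ζm : ℂ) / ζp, γ * δ * ζm * ζp]) *
    ((δ - γ) / (γ * δ * qPochs q [δ / γ, γ / δ, (q : ℂ), (q : ℂ)]))

/-- `P(x) = √|x| θ_q(xδ) / √(θ_q(xγ, xδ))`. Near the points of the two-sided lattice the
radicand is a positive real number. -/
def funP (q : ℝ) (γ δ : ℂ) (x : ℝ) : ℂ :=
  (Real.sqrt |x| : ℂ) * (theta q (x * δ) / posSqrt (thetas q [x * γ, x * δ]))

/-- `Q(x) = √|x| θ_q(xγ) / √(θ_q(xγ, xδ))`. -/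
def funQ (q : ℝ) (γ δ : ℂ) (x : ℝ) : ℂ :=
  (Real.sqrt |x| : ℂ) * (theta q (x * γ) / posSqrt (thetas q [x * γ, x * δ]))

open Classical in
/-- The elliptic tail kernel for `γ ≠ δ`; on the diagonal it is given by L'Hôpital's rule. -/
def kernelOfNe (q ζp ζm : ℝ) (γ δ : ℂ) (x y : ℝ) : ℂ :=
  if x = y then
    constC q ζp ζm γ δ *
      (deriv (funP q γ δ) x * funQ q γ δ x - deriv (funQ q γ δ) x * funP q γ δ x)
  else
    constC q ζp ζm γ δ *
      ((funP q γ δ x * funQ q γ δ y - funQ q γ δ x * funP q γ δ y) / ((x : ℂ) - y))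

open Classical in
/-- The elliptic tail kernel `K^{γ,δ}(x, y)` of an admissible pair. For `γ = δ`, where the
formula for `γ ≠ δ` has the indeterminate form `0 / 0`, it is the limit of `K^{γ,d}(x, y)`
as `d → γ`, `d ≠ γ`, through admissible pairs `(γ, d)`. -/
def kernel (q ζp ζm : ℝ) (γ δ : ℂ) (x y : ℝ) : ℂ :=
  if γ = δ then
    limUnder (𝓝[{d : ℂ | IsAdmissiblePair q ζp ζm γ d ∧ d ≠ γ}] γ)
      (fun d => kernelOfNe q ζp ζm γ d x y)
  else kernelOfNe q ζp ζm γ δ x y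

/-- The two signs, which label the two halves of the lattice. -/
inductive Sgn
  | plus
  | minus

/-- The number `ζ_±`. -/
def zeta (ζp ζm : ℝ) : Sgn → ℝ
  | Sgn.plus => ζp
  | Sgn.minus => ζm

/-- The point `ζ_s q^m` of the two-sided lattice `ζ_- q^ℤ ⊔ ζ_+ q^ℤ`. -/
def latticePoint (q ζp ζm : ℝ) (s : Sgn) (m : ℤ) : ℝ := zeta ζp ζm s * q ^ m

/-- The gauge factor: `1` at `ζ_+ q^m` and `(-1)^m` at `ζ_- q^m`. -/
def gauge : Sgn → ℤ → ℂ
  | Sgn.plus, _ => 1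
  | Sgn.minus, m => (-1) ^ m

/-- The gauge-transformed kernel at the lattice points `ζ_s q^m` and `ζ_t q^n`. -/
def gaugedKernel (q ζp ζm : ℝ) (γ δ : ℂ) (s : Sgn) (m : ℤ) (t : Sgn) (n : ℤ) : ℂ :=
  gauge s m * (gauge t n)⁻¹ *
    kernel q ζp ζm γ δ (latticePoint q ζp ζm s m) (latticePoint q ζp ζm t n)

/-- The `2 × 2` matrix-valued kernel on `ℤ`. -/
def matrixKernel (q ζp ζm : ℝ) (γ δ : ℂ) (m n : ℤ) : Matrix Sgn Sgn ℂ :=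
  Matrix.of fun s t => gaugedKernel q ζp ζm γ δ s m t n

/-- The Fourier transform of `m ↦ matrixKernel m 0`. -/
def fourierSymbol (q ζp ζm : ℝ) (γ δ : ℂ) (η : ℝ) : Matrix Sgn Sgn ℂ :=
  Matrix.of fun s t =>
    ∑' m : ℤ, Complex.exp (Complex.I * η * m) * matrixKernel q ζp ζm γ δ m 0 s t

end EllipticTail

end

noncomputable section

namespace EllipticTail

/-! ### The infinite Pochhammer symbol -/

/-! Quasi-periodicity of `theta` gives `P(ζ q^m) = (|ζ| / (-ζ))^m (√(qγδ) / δ)^m P(ζ)`, and likewise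
for `Q` with `γ` and `δ` exchanged (`funP_mul_zpow`). The gauge turns the sign into `(-1)^m` on both
halves of the lattice. With `u = -√(qγδ)/δ` and `v = -√(qγδ)/γ`, so that `uv = q` and `uδ = vγ`, the
gauged kernel at `x q^m` and `y` is therefore a constant times `(θ(xδ)θ(yγ) u^m - θ(xγ)θ(yδ) v^m) /
(x q^m - y)` (`gauged_kernelOfNe`). Admissibility gives `q < |u|, |v| < 1` and positive radicands
(`IsAdmissiblePair.facts`).

For `x/y` outside `q^ℤ` and `|w| = 1`, the Fourier series is a combination of two Kronecker series,
summed by `tsum_kronecker`. The three-term relation `theta_three_term` merges the two results into a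
single product and cancels the denominator `θ(x/y)`. Both identities rest on one uniqueness
principle: a function on `ℂ ∖ {0}` with only removable singularities and `h(qz) = l h(z)`, `1 < |l|
< 1/q`, vanishes, because `|h(z)| |z|^a` is bounded for some `0 < a < 1` (`eq_zero_of_q_shift`).

Two degenerate cases follow by termwise differentiation of dominated series
(`hasSum_deriv_of_dominated`). If `x = y`, the identity for nearby `x`, multiplied by `x - y`, is
differentiated at `x = y`; the term `m = 0` then yields the Wronskian on the diagonal
(`hasSum_core_diag`). If `γ = δ`, the second parameter is moved along `γ / r²`, and the derivative
at `r = 1` is matched with the limit that defines the kernel (`hasSum_deriv_confluentCore`,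
`gaugedKernel_confluent`). The factor `θ(γ/δ)` in the constant cancels the same factor in the sum,
so both cases end in the single formula `hasSum_gaugedKernel`. -/

lemma summable_norm_neg_mul_pow {q : ℝ} (hq : 0 < q ∧ q < 1) (z : ℂ) :
    Summable fun i : ℕ => ‖-(z * (q : ℂ) ^ i)‖ := by
  have : Summable fun i : ℕ => ‖z‖ * q ^ i :=
    (summable_geometric_of_lt_one hq.1.le hq.2).mul_left _
  refine this.congr fun i => ?_
  simp [abs_of_pos hq.1]

lemma multipliable_qPoch {q : ℝ} (hq : 0 < q ∧ q < 1) (z : ℂ) :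
    Multipliable fun i : ℕ => (1 - z * (q : ℂ) ^ i) := by
  simpa [sub_eq_add_neg] using
    multipliable_one_add_of_summable (summable_norm_neg_mul_pow hq z)

lemma qPoch_eq_mul {q : ℝ} (hq : 0 < q ∧ q < 1) (z : ℂ) :
    qPoch q z = (1 - z) * qPoch q (q * z) := by
  unfold qPoch
  rw [tprod_eq_zero_mul' (f := fun i : ℕ => (1 - z * (q : ℂ) ^ i))]
  · congr 1
    · simp
    · refine tprod_congr fun i => ?_
      ring
  · refine (multipliable_qPoch hq (q * z)).congr fun i => ?_
    ring

lemma qPoch_ne_zero {q : ℝ} (hq : 0 < q ∧ q < 1) {z : ℂ} (h : ∀ i : ℕ, z * (q : ℂ) ^ i ≠ 1) :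
    qPoch q z ≠ 0 := by
  have := tprod_one_add_ne_zero_of_summable (f := fun i : ℕ => -(z * (q : ℂ) ^ i))
    (fun i => by
      intro h0
      exact h i (by linear_combination -h0)) (summable_norm_neg_mul_pow hq z)
  simpa [qPoch, sub_eq_add_neg] using this

lemma qPoch_ne_zero_of_norm_lt {q : ℝ} (hq : 0 < q ∧ q < 1) {z : ℂ} (h : ‖z‖ < 1) :
    qPoch q z ≠ 0 := by
  refine qPoch_ne_zero hq fun i hi => ?_
  have h1 : ‖z * (q : ℂ) ^ i‖ = 1 := by rw [hi]; simp
  rw [norm_mul, norm_pow, Complex.norm_real, Real.norm_of_nonneg hq.1.le] at h1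
  have h2 : q ^ i ≤ 1 := pow_le_one₀ hq.1.le hq.2.le
  have h3 : 0 < q ^ i := pow_pos hq.1 i
  nlinarith [norm_nonneg z]

lemma differentiable_qPoch {q : ℝ} (hq : 0 < q ∧ q < 1) : Differentiable ℂ (qPoch q) := by
  intro z
  have hU : IsOpen (Metric.ball (0 : ℂ) (‖z‖ + 1)) := Metric.isOpen_ball
  have hs : Summable fun i : ℕ => (‖z‖ + 1) * q ^ i :=
    (summable_geometric_of_lt_one hq.1.le hq.2).mul_left _
  have key := hs.hasProdLocallyUniformlyOn_nat_one_add (f := fun i (x : ℂ) => -(x * (q : ℂ) ^ i))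
    hU (Eventually.of_forall fun i x hx => by
      rw [norm_neg, norm_mul, norm_pow, Complex.norm_real, Real.norm_of_nonneg hq.1.le]
      have : ‖x‖ < ‖z‖ + 1 := by simpa using hx
      have := pow_pos hq.1 i
      gcongr) (fun i => by fun_prop)
  have hd := key.differentiableOn (.of_forall fun _ ↦ by
    simpa [Finset.prod_fn] using DifferentiableOn.finsetProd (fun _ _ ↦ by fun_prop)) hU
  have hz : Metric.ball (0 : ℂ) (‖z‖ + 1) ∈ 𝓝 z := hU.mem_nhds (by simp)
  have := hd.differentiableAt hz
  refine this.congr_of_eventuallyEq (Eventually.of_forall fun x => ?_)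
  simp [qPoch, sub_eq_add_neg]

/-! ### The theta function -/

/-- The cofactor of the zero `z = 1` in `θ_q(z) = (1 - z) (qz; q)_∞ (q / z; q)_∞`. -/
def thetaReg (q : ℝ) (z : ℂ) : ℂ := qPoch q (q * z) * qPoch q ((q : ℂ) / z)

lemma theta_eq_mul_thetaReg {q : ℝ} (hq : 0 < q ∧ q < 1) (z : ℂ) :
    theta q z = (1 - z) * thetaReg q z := by
  rw [theta, thetaReg, qPoch_eq_mul hq z]; ring

lemma thetaReg_one {q : ℝ} : thetaReg q 1 = qPoch q q ^ 2 := by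
  simp [thetaReg, sq]

lemma qPoch_self_ne_zero {q : ℝ} (hq : 0 < q ∧ q < 1) : qPoch q q ≠ 0 :=
  qPoch_ne_zero_of_norm_lt hq (by simpa [abs_of_pos hq.1] using hq.2)

lemma ofReal_ne_zero_of_pos {q : ℝ} (hq : 0 < q) : (q : ℂ) ≠ 0 := by
  exact_mod_cast hq.ne'

lemma differentiableAt_thetaReg {q : ℝ} (hq : 0 < q ∧ q < 1) {z : ℂ} (hz : z ≠ 0) :
    DifferentiableAt ℂ (thetaReg q) z := by
  have h1 : DifferentiableAt ℂ (fun x : ℂ => qPoch q (q * x)) z :=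
    DifferentiableAt.comp z (differentiable_qPoch hq _) (by fun_prop)
  have h2 : DifferentiableAt ℂ (fun x : ℂ => qPoch q ((q : ℂ) / x)) z :=
    DifferentiableAt.comp z (differentiable_qPoch hq _)
      ((differentiableAt_const _).div differentiableAt_id hz)
  exact h1.mul h2

lemma differentiableAt_theta {q : ℝ} (hq : 0 < q ∧ q < 1) {z : ℂ} (hz : z ≠ 0) :
    DifferentiableAt ℂ (theta q) z := by
  have h2 : DifferentiableAt ℂ (fun x : ℂ => qPoch q ((q : ℂ) / x)) z :=
    DifferentiableAt.comp z (differentiable_qPoch hq _)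
      ((differentiableAt_const _).div differentiableAt_id hz)
  exact (differentiable_qPoch hq z).mul h2

lemma differentiableOn_theta {q : ℝ} (hq : 0 < q ∧ q < 1) :
    DifferentiableOn ℂ (theta q) {0}ᶜ := fun _ hz =>
  (differentiableAt_theta hq hz).differentiableWithinAt

lemma analyticAt_theta {q : ℝ} (hq : 0 < q ∧ q < 1) {z : ℂ} (hz : z ≠ 0) :
    AnalyticAt ℂ (theta q) z :=
  (differentiableOn_theta hq).analyticAt (isOpen_compl_singleton.mem_nhds hz)

lemma differentiableAt_deriv_theta {q : ℝ} (hq : 0 < q ∧ q < 1) {z : ℂ} (hz : z ≠ 0) :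
    DifferentiableAt ℂ (deriv (theta q)) z :=
  (analyticAt_theta hq hz).deriv.differentiableAt

lemma theta_q_div {q : ℝ} (hq : 0 < q ∧ q < 1) (z : ℂ) : theta q (q / z) = theta q z := by
  have := ofReal_ne_zero_of_pos hq.1
  rw [theta, theta, div_div_cancel₀ this, mul_comm]

lemma theta_inv {q : ℝ} (hq : 0 < q ∧ q < 1) {z : ℂ} (hz : z ≠ 0) :
    theta q z⁻¹ = -z⁻¹ * theta q z := by
  rw [theta, theta, qPoch_eq_mul hq z⁻¹, qPoch_eq_mul hq z, div_inv_eq_mul, div_eq_mul_inv]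
  field_simp
  ring

lemma theta_q_mul {q : ℝ} (hq : 0 < q ∧ q < 1) {z : ℂ} (hz : z ≠ 0) :
    theta q (q * z) = -z⁻¹ * theta q z := by
  rw [← theta_inv hq hz, ← theta_q_div hq z⁻¹, div_inv_eq_mul]

/-- Iteration of `theta_q_mul`. The constant is `q^(-k(k-1)/2)`, but only its positivity and its
independence of `z` are ever used. -/
lemma exists_theta_zpow_mul {q : ℝ} (hq : 0 < q ∧ q < 1) (k : ℤ) :
    ∃ c : ℝ, 0 < c ∧ ∀ z : ℂ, z ≠ 0 → theta q ((q : ℂ) ^ k * z) = c * (-z) ^ (-k) * theta q z := by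
  have hq' := ofReal_ne_zero_of_pos hq.1
  induction k with
  | zero => exact ⟨1, one_pos, fun z _ => by simp⟩
  | succ k ih =>
    obtain ⟨c, hc, h⟩ := ih
    refine ⟨c * (q ^ k)⁻¹, by have := pow_pos hq.1 k; positivity, fun z hz => ?_⟩
    have hz' : -z ≠ 0 := neg_ne_zero.mpr hz
    have e : (q : ℂ) ^ ((k : ℤ) + 1) * z = q * ((q : ℂ) ^ (k : ℤ) * z) := by
      rw [zpow_add_one₀ hq']; ring
    rw [e, theta_q_mul hq (mul_ne_zero (zpow_ne_zero _ hq') hz), h z hz, neg_add,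
      zpow_add₀ hz', zpow_neg_one]
    push_cast
    rw [mul_inv, zpow_natCast, inv_neg]
    ring
  | pred k ih =>
    obtain ⟨c, hc, h⟩ := ih
    refine ⟨c * (q ^ (-(k : ℤ) - 1)), mul_pos hc (zpow_pos hq.1 _), fun z hz => ?_⟩
    have hz' : -z ≠ 0 := neg_ne_zero.mpr hz
    have e : (q : ℂ) ^ (-(k : ℤ)) * z = q * ((q : ℂ) ^ (-(k : ℤ) - 1) * z) := by
      rw [zpow_sub_one₀ hq']; field_simp
    have hx : (q : ℂ) ^ (-(k : ℤ) - 1) * z ≠ 0 := mul_ne_zero (zpow_ne_zero _ hq') hz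
    have h1 := h z hz
    rw [e, theta_q_mul hq hx] at h1
    have e2 : -(-(k : ℤ) - 1) = -(-(k : ℤ)) + 1 := by ring
    rw [e2, zpow_add_one₀ hz']
    have h2 : theta q ((q : ℂ) ^ (-(k : ℤ) - 1) * z) =
        -((q : ℂ) ^ (-(k : ℤ) - 1) * z) * (c * (-z) ^ (-(-(k : ℤ))) * theta q z) := by
      rw [← h1]; field_simp
    rw [h2]; push_cast; ring

lemma theta_eq_zero_iff {q : ℝ} (hq : 0 < q ∧ q < 1) {z : ℂ} (hz : z ≠ 0) :
    theta q z = 0 ↔ ∃ k : ℤ, z = (q : ℂ) ^ k := by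
  have hq' := ofReal_ne_zero_of_pos hq.1
  constructor
  · intro h
    by_contra! hne
    refine mul_ne_zero (qPoch_ne_zero hq fun i hi => ?_) (qPoch_ne_zero hq fun i hi => ?_) h
    · refine hne (-i) ?_
      rw [zpow_neg, zpow_natCast]
      exact eq_inv_of_mul_eq_one_left hi
    · refine hne (i + 1) ?_
      rw [zpow_add_one₀ hq', zpow_natCast]
      field_simp at hi
      rw [← hi]; ring
  · rintro ⟨k, rfl⟩
    obtain ⟨c, -, h⟩ := exists_theta_zpow_mul hq k
    have h1 := h 1 one_ne_zero
    rw [mul_one] at h1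
    rw [h1, theta_eq_mul_thetaReg hq 1]
    simp

lemma theta_ne_zero_of_norm {q : ℝ} (hq : 0 < q ∧ q < 1) {z : ℂ} (h1 : q < ‖z‖) (h2 : ‖z‖ < 1) :
    theta q z ≠ 0 := by
  have hz : z ≠ 0 := norm_pos_iff.mp (hq.1.trans h1)
  refine mul_ne_zero (qPoch_ne_zero_of_norm_lt hq h2) (qPoch_ne_zero_of_norm_lt hq ?_)
  rw [norm_div, Complex.norm_real, Real.norm_of_nonneg hq.1.le, div_lt_one (hq.1.trans h1)]
  exact h1

lemma thetaReg_one_ne_zero {q : ℝ} (hq : 0 < q ∧ q < 1) : thetaReg q 1 ≠ 0 := by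
  rw [thetaReg_one]; exact pow_ne_zero _ (qPoch_self_ne_zero hq)

/-! ### Uniqueness of solutions of `h(qz) = l h(z)` -/

/-- Reduces a statement about a whole orbit `q^ℤ z` to one representative: a bound to the annulus `q
≤ |z| ≤ 1`, or removability to a single pole. -/
lemma zpow_mul_iff_of_mul_iff {q : ℝ} (hq : 0 < q ∧ q < 1) {p : ℂ → Prop}
    (h : ∀ z : ℂ, z ≠ 0 → (p (q * z) ↔ p z)) (n : ℤ) {z : ℂ} (hz : z ≠ 0) :
    p ((q : ℂ) ^ n * z) ↔ p z := by
  have hq' := ofReal_ne_zero_of_pos hq.1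
  have hne : ∀ m : ℤ, (q : ℂ) ^ m * z ≠ 0 := fun m => mul_ne_zero (zpow_ne_zero _ hq') hz
  induction n with
  | zero => simp
  | succ k ih => rw [zpow_add_one₀ hq', mul_comm _ (q : ℂ), mul_assoc, h _ (hne _)]; exact ih
  | pred k ih =>
    rw [← h _ (hne (-(k : ℤ) - 1)), ← mul_assoc, ← zpow_one_add₀ hq', add_sub_cancel]
    exact ih

lemma exists_zpow_mul_mem_annulus {q : ℝ} (hq : 0 < q ∧ q < 1) {z : ℂ} (hz : z ≠ 0) :
    ∃ n : ℤ, q ≤ ‖(q : ℂ) ^ n * z‖ ∧ ‖(q : ℂ) ^ n * z‖ ≤ 1 := by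
  obtain ⟨n, h1, h2⟩ := exists_mem_Ioc_zpow (norm_pos_iff.mpr hz) ((one_lt_inv₀ hq.1).mpr hq.2)
  refine ⟨n + 1, ?_, ?_⟩ <;>
    rw [norm_mul, norm_zpow, Complex.norm_real, Real.norm_of_nonneg hq.1.le]
  · rw [inv_zpow] at h1
    have := zpow_pos hq.1 n
    rw [zpow_add_one₀ hq.1.ne']
    have h3 : 1 ≤ q ^ n * ‖z‖ := ((inv_lt_iff_one_lt_mul₀' this).mp h1).le
    nlinarith [hq.1]
  · rw [inv_zpow] at h2
    have := zpow_pos hq.1 (n + 1)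
    calc q ^ (n + 1) * ‖z‖ ≤ q ^ (n + 1) * (q ^ (n + 1))⁻¹ := by gcongr
      _ = 1 := mul_inv_cancel₀ this.ne'

/-- Taking punctured limits erases the values that division by zero assigns at isolated
singularities and leaves the analytic continuation. -/
lemma limUnder_eventuallyEq {h g : ℂ → ℂ} {z : ℂ} (hg : AnalyticAt ℂ g z)
    (hh : h =ᶠ[𝓝[≠] z] g) : (fun y => limUnder (𝓝[≠] y) h) =ᶠ[𝓝 z] g := by
  have h1 : ∀ᶠ y in 𝓝 z, h =ᶠ[𝓝[≠] y] g := by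
    have h2 := eventually_eventually_nhdsWithin.mpr hh
    rw [eventually_nhdsWithin_iff] at h2
    filter_upwards [h2] with y hy
    by_cases hyz : y = z
    · rw [hyz]; exact hh
    · have h3 := hy hyz
      rw [(isOpen_compl_singleton (x := z)).nhdsWithin_eq hyz] at h3
      exact h3.filter_mono nhdsWithin_le_nhds
  filter_upwards [h1, hg.eventually_analyticAt] with y hy hgy
  exact ((hgy.continuousAt.tendsto.mono_left nhdsWithin_le_nhds).congr' hy.symm).limUnder_eq

/-- A Liouville argument. The weighted modulus `|H(z)| |z|^a` is invariant under `z ↦ qz`, hence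
bounded. Since `0 < a < 1`, the singularity at `0` is removable and `H` tends to `0` at infinity. -/
lemma eq_zero_of_q_shift {q : ℝ} (hq : 0 < q ∧ q < 1) {H : ℂ → ℂ} {l : ℂ} (hl1 : 1 < ‖l‖)
    (hl2 : ‖l‖ < q⁻¹) (hd : ∀ z : ℂ, z ≠ 0 → DifferentiableAt ℂ H z)
    (hs : ∀ z : ℂ, z ≠ 0 → H (q * z) = l * H z) {z : ℂ} (hz : z ≠ 0) : H z = 0 := by
  have hlq : Real.log q < 0 := Real.log_neg hq.1 hq.2
  -- The exponent solving `|l| q^a = 1`; the bounds `1 < |l| < 1/q` say exactly that `0 < a < 1`.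
  obtain ⟨a, ha⟩ : ∃ a : ℝ, a = -(Real.log ‖l‖ / Real.log q) := ⟨_, rfl⟩
  have hla : ‖l‖ * q ^ a = 1 := by
    rw [Real.rpow_def_of_pos hq.1, ha]
    have e : Real.log q * -(Real.log ‖l‖ / Real.log q) = -Real.log ‖l‖ := by
      have := hlq.ne
      field_simp
    rw [e, Real.exp_neg, Real.exp_log (by linarith)]
    exact mul_inv_cancel₀ (by linarith)
  have hll : 0 < Real.log ‖l‖ := Real.log_pos hl1
  have ha0 : 0 < a := by rw [ha]; exact neg_pos.mpr (div_neg_of_pos_of_neg hll hlq)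
  have ha1 : a < 1 := by
    have h1 : Real.log ‖l‖ < -Real.log q := by
      rw [← Real.log_inv]; exact Real.log_lt_log (by linarith) hl2
    rw [ha, neg_lt, lt_div_iff_of_neg hlq]; linarith
  have hinv : ∀ x : ℂ, x ≠ 0 → ‖H (q * x)‖ * ‖(q : ℂ) * x‖ ^ a = ‖H x‖ * ‖x‖ ^ a := by
    intro x hx
    rw [hs x hx, norm_mul, norm_mul, Complex.norm_real, Real.norm_of_nonneg hq.1.le,
      Real.mul_rpow hq.1.le (norm_nonneg _)]
    linear_combination ‖H x‖ * ‖x‖ ^ a * hla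
  have hK : IsCompact {x : ℂ | q ≤ ‖x‖ ∧ ‖x‖ ≤ 1} := by
    refine (isCompact_closedBall (0 : ℂ) 1).of_isClosed_subset ?_ fun x hx => by simpa using hx.2
    exact (isClosed_le continuous_const continuous_norm).inter
      (isClosed_le continuous_norm continuous_const)
  obtain ⟨M, hM⟩ := hK.exists_bound_of_continuousOn (f := fun x => ‖H x‖ * ‖x‖ ^ a) (by
    intro x hx
    have hx0 : x ≠ 0 := norm_pos_iff.mp (hq.1.trans_le hx.1)
    exact ((hd x hx0).continuousAt.norm.mul (continuousAt_id.norm.rpow_const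
      (Or.inl (norm_ne_zero_iff.mpr hx0)))).continuousWithinAt)
  have hM' : ∀ x : ℂ, x ≠ 0 → ‖H x‖ * ‖x‖ ^ a ≤ M := by
    intro x hx
    obtain ⟨n, hn⟩ := exists_zpow_mul_mem_annulus hq hx
    have h1 := (zpow_mul_iff_of_mul_iff hq (p := fun x => ‖H x‖ * ‖x‖ ^ a ≤ M)
      (fun y hy => by rw [hinv y hy]) n hx).mp (le_of_abs_le (hM _ hn))
    exact h1
  -- Near `0`, `|x H(x)| ≤ M |x|^(1-a)`, so `x H(x)` extends holomorphically by `0`. Its difference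
  -- quotient at `0` is the entire extension of `H`.
  have hF : DifferentiableOn ℂ (fun x => x * H x) Set.univ := by
    refine (Complex.differentiableOn_compl_singleton_and_continuousAt_iff
      (c := 0) Filter.univ_mem).mp ⟨fun x hx => ?_, ?_⟩
    · exact (differentiableAt_id.mul (hd x hx.2)).differentiableWithinAt
    · have h0 : Tendsto (fun x : ℂ => M * ‖x‖ ^ (1 - a)) (𝓝 0) (𝓝 0) := by
        have : Tendsto (fun x : ℂ => ‖x‖ ^ (1 - a)) (𝓝 0) (𝓝 (‖(0 : ℂ)‖ ^ (1 - a))) :=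
          continuousAt_id.norm.rpow_const (Or.inr (by linarith))
        rw [norm_zero, Real.zero_rpow (by linarith)] at this
        simpa using this.const_mul M
      rw [ContinuousAt, zero_mul]
      refine squeeze_zero_norm (fun x => ?_) h0
      rcases eq_or_ne x 0 with rfl | hx
      · simp [Real.zero_rpow (by linarith : 1 - a ≠ 0)]
      · have hx' := norm_pos_iff.mpr hx
        rw [norm_mul, Real.rpow_sub hx', Real.rpow_one, ← mul_div_assoc, le_div_iff₀
          (Real.rpow_pos_of_pos hx' _)]
        nlinarith [hM' x hx]
  have hG : Differentiable ℂ (dslope (fun x => x * H x) 0) := by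
    rw [← differentiableOn_univ]
    exact (Complex.differentiableOn_dslope Filter.univ_mem).mpr hF
  have hGH : ∀ x : ℂ, x ≠ 0 → dslope (fun x => x * H x) 0 x = H x := by
    intro x hx
    rw [dslope_of_ne _ hx, slope_def_field]
    simp only [zero_mul, sub_zero]
    exact mul_div_cancel_left₀ _ hx
  rw [← hGH z hz]
  refine hG.apply_eq_of_tendsto_cocompact z (c := 0) ?_
  have h0 : Tendsto (fun x : ℂ => M * ‖x‖ ^ (-a)) (cocompact ℂ) (𝓝 0) := by
    simpa using ((tendsto_rpow_neg_atTop ha0).comp tendsto_norm_cocompact_atTop).const_mul M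
  refine squeeze_zero_norm' ?_ h0
  have : ∀ᶠ x : ℂ in cocompact ℂ, x ≠ 0 := isCompact_singleton.compl_mem_cocompact
  filter_upwards [this] with x hx
  have hx' := norm_pos_iff.mpr hx
  rw [hGH x hx, Real.rpow_neg hx'.le, ← div_eq_mul_inv, le_div_iff₀ (Real.rpow_pos_of_pos hx' _)]
  exact hM' x hx

/-- A function on `ℂ ∖ {0}` with removable singularities and `h(qz) = l h(z)`, `1 < |l| < 1/q`,
vanishes. -/
theorem eq_zero_of_q_shift_of_removable {q : ℝ} (hq : 0 < q ∧ q < 1) {h : ℂ → ℂ} {l : ℂ}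
    (hl1 : 1 < ‖l‖) (hl2 : ‖l‖ < q⁻¹)
    (hext : ∀ z : ℂ, z ≠ 0 → ∃ g : ℂ → ℂ, AnalyticAt ℂ g z ∧ h =ᶠ[𝓝[≠] z] g)
    (hs : ∀ z : ℂ, z ≠ 0 → h (q * z) = l * h z) {z : ℂ} (hz : z ≠ 0) (hc : ContinuousAt h z) :
    h z = 0 := by
  have hq' := ofReal_ne_zero_of_pos hq.1
  have hH : ∀ y : ℂ, y ≠ 0 → DifferentiableAt ℂ (fun y => limUnder (𝓝[≠] y) h) y ∧
      Tendsto h (𝓝[≠] y) (𝓝 (limUnder (𝓝[≠] y) h)) := by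
    intro y hy
    obtain ⟨g, hg, hhg⟩ := hext y hy
    have h1 := limUnder_eventuallyEq hg hhg
    refine ⟨hg.differentiableAt.congr_of_eventuallyEq h1, ?_⟩
    have h2 : limUnder (𝓝[≠] y) h = g y := h1.self_of_nhds
    rw [h2]
    exact (hg.continuousAt.tendsto.mono_left nhdsWithin_le_nhds).congr' hhg.symm
  -- The functional equation passes to the punctured limits, since `x ↦ qx` maps punctured
  -- neighbourhoods to punctured neighbourhoods.
  have h0 := eq_zero_of_q_shift hq hl1 hl2 (fun y hy => (hH y hy).1) (by
    intro y hy
    have hqy : (q : ℂ) * y ≠ 0 := mul_ne_zero hq' hy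
    have t1 : Tendsto (fun x : ℂ => (q : ℂ) * x) (𝓝[≠] y) (𝓝[≠] (q * y)) := by
      refine tendsto_nhdsWithin_iff.mpr ⟨?_, ?_⟩
      · exact ((continuous_const_mul (q : ℂ)).tendsto y).mono_left nhdsWithin_le_nhds
      · filter_upwards [self_mem_nhdsWithin] with x hx hxy
        exact hx (mul_left_cancel₀ hq' hxy)
    refine tendsto_nhds_unique ((hH _ hqy).2.comp t1) ?_
    refine ((hH y hy).2.const_mul l).congr' ?_
    have : ∀ᶠ x in 𝓝[≠] y, x ≠ 0 := nhdsWithin_le_nhds (isOpen_ne.mem_nhds hy)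
    filter_upwards [this] with x hx
    exact (hs x hx).symm) hz
  rw [← h0]
  exact tendsto_nhds_unique (hc.tendsto.mono_left nhdsWithin_le_nhds) (hH z hz).2

/-! ### Bilateral geometric-type series -/

lemma norm_ofReal_zpow {q : ℝ} (hq : 0 < q ∧ q < 1) (m : ℤ) : ‖(q : ℂ) ^ m‖ = q ^ m := by
  rw [norm_zpow, Complex.norm_real, Real.norm_of_nonneg hq.1.le]

/-- The series is dominated by `ρ^n` towards `+∞` and by `(q/ρ)^n` towards `-∞`; these converge
exactly for `q < ρ < 1`. -/
lemma summable_int_zpow_div {q : ℝ} (hq : 0 < q ∧ q < 1) {ρ : ℝ} (h1 : q < ρ) (h2 : ρ < 1) :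
    Summable fun m : ℤ => ρ ^ m / (1 + q ^ m) := by
  have hρ : 0 < ρ := hq.1.trans h1
  refine Summable.of_nat_of_neg ?_ ?_
  · refine (summable_geometric_of_lt_one hρ.le h2).of_nonneg_of_le (fun n => ?_) fun n => ?_
    · have := zpow_pos hq.1 n; have := zpow_pos hρ n; positivity
    · have := pow_pos hq.1 n; have := pow_pos hρ n
      rw [zpow_natCast, zpow_natCast, div_le_iff₀ (by positivity)]
      nlinarith
  · refine (summable_geometric_of_lt_one (r := q / ρ) (by have := hq.1; positivity)
      ((div_lt_one hρ).mpr h1)).of_nonneg_of_le (fun n => ?_) fun n => ?_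
    · have := zpow_pos hq.1 (-n); have := zpow_pos hρ (-n); positivity
    · have h3 := pow_pos hq.1 n; have h4 := pow_pos hρ n
      rw [zpow_neg, zpow_neg, zpow_natCast, zpow_natCast, div_le_iff₀ (by positivity), div_pow]
      have : q ^ n / ρ ^ n * (1 + (q ^ n)⁻¹) = q ^ n / ρ ^ n + (ρ ^ n)⁻¹ := by
        field_simp
      rw [this]
      have : 0 < q ^ n / ρ ^ n := by positivity
      linarith

lemma tendsto_zpow_atBot_atTop {q : ℝ} (hq : 0 < q ∧ q < 1) :
    Tendsto (fun m : ℤ => q ^ m) atBot atTop := by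
  have h : Tendsto (fun n : ℕ => (q⁻¹) ^ n) atTop atTop :=
    tendsto_pow_atTop_atTop_of_one_lt ((one_lt_inv₀ hq.1).mpr hq.2)
  refine tendsto_atTop.mpr fun b => ?_
  obtain ⟨n, hn⟩ := (tendsto_atTop.mp h b).exists
  filter_upwards [eventually_le_atBot (-(n : ℤ))] with m hm
  refine hn.trans ?_
  rw [inv_pow, ← zpow_natCast, ← zpow_neg]
  exact zpow_le_zpow_right_of_le_one₀ hq.1 hq.2.le hm

lemma tendsto_zpow_atTop_zero_int {q : ℝ} (hq : 0 < q ∧ q < 1) :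
    Tendsto (fun m : ℤ => q ^ m) atTop (𝓝 0) := by
  have h := (tendsto_zpow_atBot_atTop hq).comp (tendsto_neg_atTop_atBot (G := ℤ))
  refine h.inv_tendsto_atTop.congr fun m => ?_
  simp

/-- Towards `+∞` the modulus tends to `1`, and towards `-∞` it grows like `|z| q^m`; the finitely
many remaining indices only shrink the constant. -/
lemma exists_le_norm_one_sub {q : ℝ} (hq : 0 < q ∧ q < 1) {z : ℂ} (hz : z ≠ 0) :
    ∃ c : ℝ, 0 < c ∧ ∀ m : ℤ, z * (q : ℂ) ^ m ≠ 1 → c * (1 + q ^ m) ≤ ‖1 - z * (q : ℂ) ^ m‖ := by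
  have hz' := norm_pos_iff.mpr hz
  -- The bound `a ≤ 1/4` serves the end where the modulus is at least `1/2` and `1 + q^m ≤ 2`; the
  -- bound `a ≤ |z|/4` serves the end where it is at least `|z| q^m / 2` and `1 + q^m ≤ 2 q^m`.
  obtain ⟨a, ha⟩ : ∃ a : ℝ, a = min 1 ‖z‖ / 4 := ⟨_, rfl⟩
  have ha0 : 0 < a := by rw [ha]; positivity
  have ha1 : a ≤ 1 / 4 := by rw [ha]; have := min_le_left 1 ‖z‖; linarith
  have ha2 : a ≤ ‖z‖ / 4 := by rw [ha]; have := min_le_right 1 ‖z‖; linarith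
  have hev : ∀ᶠ m : ℤ in cofinite, a * (1 + q ^ m) ≤ ‖1 - z * (q : ℂ) ^ m‖ := by
    rw [Int.cofinite_eq, eventually_sup]
    constructor
    · filter_upwards [(tendsto_zpow_atBot_atTop hq).eventually_ge_atTop (max 1 (2 / ‖z‖))]
        with m hm
      have h1 : 1 ≤ q ^ m := (le_max_left _ _).trans hm
      have h2 : 2 ≤ ‖z‖ * q ^ m := by
        have := (le_max_right _ _).trans hm
        rwa [div_le_iff₀ hz', mul_comm] at this
      have h3 := norm_sub_norm_le (z * (q : ℂ) ^ m) 1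
      rw [norm_mul, norm_ofReal_zpow hq, norm_one, norm_sub_rev] at h3
      nlinarith
    · have : 0 < min 1 (1 / (2 * ‖z‖)) := by positivity
      filter_upwards [(tendsto_zpow_atTop_zero_int hq).eventually_le_const this] with m hm
      have h1 : q ^ m ≤ 1 := hm.trans (min_le_left _ _)
      have h2 : ‖z‖ * q ^ m ≤ 1 / 2 := by
        have := hm.trans (min_le_right _ _)
        rw [le_div_iff₀ (by positivity)] at this
        linarith
      have h3 := norm_sub_norm_le 1 (z * (q : ℂ) ^ m)
      rw [norm_mul, norm_ofReal_zpow hq, norm_one] at h3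
      nlinarith
  have hfin : {m : ℤ | ¬ a * (1 + q ^ m) ≤ ‖1 - z * (q : ℂ) ^ m‖}.Finite := hev
  obtain ⟨b, hb, hb'⟩ : ∃ b : ℝ, 0 < b ∧ ∀ m ∈ hfin.toFinset, z * (q : ℂ) ^ m ≠ 1 →
      b * (1 + q ^ m) ≤ ‖1 - z * (q : ℂ) ^ m‖ := by
    induction hfin.toFinset using Finset.induction_on with
    | empty => exact ⟨1, one_pos, by simp⟩
    | insert m s hm ih =>
      obtain ⟨b, hb, h⟩ := ih
      by_cases h0 : z * (q : ℂ) ^ m = 1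
      · refine ⟨b, hb, fun k hk hk1 => ?_⟩
        rcases Finset.mem_insert.mp hk with rfl | hk
        · exact absurd h0 hk1
        · exact h k hk hk1
      · have hp : 0 < ‖1 - z * (q : ℂ) ^ m‖ := norm_pos_iff.mpr (sub_ne_zero.mpr (Ne.symm h0))
        refine ⟨min b (‖1 - z * (q : ℂ) ^ m‖ / (1 + q ^ m)),
          lt_min hb (div_pos hp (by have := zpow_pos hq.1 m; positivity)), fun k hk hk1 => ?_⟩
        have hk' : 0 < 1 + q ^ k := by have := zpow_pos hq.1 k; positivity
        rcases Finset.mem_insert.mp hk with rfl | hk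
        · exact (mul_le_mul_of_nonneg_right (min_le_right _ _) hk'.le).trans
            (div_mul_cancel₀ _ hk'.ne').le
        · exact (mul_le_mul_of_nonneg_right (min_le_left _ _) hk'.le).trans (h k hk hk1)
  refine ⟨min a b, lt_min ha0 hb, fun m hm => ?_⟩
  have hm' : 0 < 1 + q ^ m := by have := zpow_pos hq.1 m; positivity
  by_cases h : a * (1 + q ^ m) ≤ ‖1 - z * (q : ℂ) ^ m‖
  · exact (mul_le_mul_of_nonneg_right (min_le_left _ _) hm'.le).trans h
  · exact (mul_le_mul_of_nonneg_right (min_le_right _ _) hm'.le).trans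
      (hb' m (hfin.mem_toFinset.mpr h) hm)

lemma exists_le_norm_one_sub_near {q : ℝ} (hq : 0 < q ∧ q < 1) {z : ℂ} (hz : z ≠ 0) :
    ∃ c : ℝ, 0 < c ∧ ∀ x ∈ Metric.ball z c, ∀ m : ℤ, z * (q : ℂ) ^ m ≠ 1 →
      c * (1 + q ^ m) ≤ ‖1 - x * (q : ℂ) ^ m‖ := by
  obtain ⟨c, hc, h⟩ := exists_le_norm_one_sub hq hz
  refine ⟨c / 2, by positivity, fun x hx m hm => ?_⟩
  have h1 := h m hm
  have h2 := norm_sub_norm_le (1 - z * (q : ℂ) ^ m) ((x - z) * (q : ℂ) ^ m)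
  rw [show 1 - z * (q : ℂ) ^ m - (x - z) * (q : ℂ) ^ m = 1 - x * (q : ℂ) ^ m by ring,
    norm_mul, norm_ofReal_zpow hq] at h2
  have h3 : ‖x - z‖ < c / 2 := by simpa [dist_eq_norm] using hx
  have := zpow_pos hq.1 m
  nlinarith

lemma summable_kronecker {q : ℝ} (hq : 0 < q ∧ q < 1) {w z : ℂ} (h1 : q < ‖w‖) (h2 : ‖w‖ < 1)
    (hz : z ≠ 0) : Summable fun m : ℤ => w ^ m / (1 - z * (q : ℂ) ^ m) := by
  obtain ⟨c, hc, h⟩ := exists_le_norm_one_sub hq hz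
  refine ((summable_int_zpow_div hq h1 h2).mul_left c⁻¹).of_norm_bounded fun m => ?_
  have hp := zpow_pos hq.1 m
  have hw : 0 < ‖w‖ ^ m := zpow_pos (hq.1.trans h1) m
  rw [norm_div, norm_zpow]
  by_cases hm : z * (q : ℂ) ^ m = 1
  · rw [hm, sub_self, norm_zero, div_zero]; positivity
  · rw [inv_mul_eq_div, div_div, mul_comm (1 + q ^ m)]
    exact div_le_div_of_nonneg_left hw.le (by positivity) (h m hm)

/-- The terms with a pole at `z` itself are dropped, so the remaining series converges uniformly on
a ball around `z`, whether or not `z` lies in `q^ℤ`. -/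
lemma analyticAt_tsum_kronecker {q : ℝ} (hq : 0 < q ∧ q < 1) {w z : ℂ} (h1 : q < ‖w‖)
    (h2 : ‖w‖ < 1) (hz : z ≠ 0) :
    AnalyticAt ℂ (fun x => ∑' m : ℤ, if z * (q : ℂ) ^ m = 1 then 0
      else w ^ m / (1 - x * (q : ℂ) ^ m)) z := by
  obtain ⟨c, hc, h⟩ := exists_le_norm_one_sub_near hq hz
  refine (Complex.differentiableOn_tsum_of_summable_norm
    ((summable_int_zpow_div hq h1 h2).mul_left c⁻¹) (fun m => ?_) Metric.isOpen_ball
    fun m x hx => ?_).analyticAt (Metric.ball_mem_nhds z hc)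
  · split_ifs with hm
    · exact differentiableOn_const _
    · intro x hx
      have hp := zpow_pos hq.1 m
      have : 1 - x * (q : ℂ) ^ m ≠ 0 := by
        have := h x hx m hm
        exact norm_pos_iff.mp (lt_of_lt_of_le (by positivity) this)
      have hd : DifferentiableAt ℂ (fun x : ℂ => 1 - x * (q : ℂ) ^ m) x := by fun_prop
      exact ((differentiableAt_const _).fun_div hd this).differentiableWithinAt
  · have hp := zpow_pos hq.1 m
    have hw : 0 < ‖w‖ ^ m := zpow_pos (hq.1.trans h1) m
    split_ifs with hm
    · rw [norm_zero]; positivity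
    · rw [norm_div, norm_zpow, inv_mul_eq_div, div_div, mul_comm (1 + q ^ m)]
      exact div_le_div_of_nonneg_left hw.le (by positivity) (h x hx m hm)

/-- Makes removability a `q`-invariant property, so that one pole per orbit needs inspection. -/
lemma removable_q_mul_iff {q : ℝ} (hq : 0 < q ∧ q < 1) {h : ℂ → ℂ} {l : ℂ} (hl : l ≠ 0)
    (hs : ∀ z : ℂ, z ≠ 0 → h (q * z) = l * h z) {z : ℂ} (hz : z ≠ 0) :
    (∃ g : ℂ → ℂ, AnalyticAt ℂ g (q * z) ∧ h =ᶠ[𝓝[≠] (q * z)] g) ↔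
      ∃ g : ℂ → ℂ, AnalyticAt ℂ g z ∧ h =ᶠ[𝓝[≠] z] g := by
  have hq' := ofReal_ne_zero_of_pos hq.1
  have key : ∀ a : ℂ, a ≠ 0 → ∀ y : ℂ, Tendsto (fun x : ℂ => a * x) (𝓝[≠] y) (𝓝[≠] (a * y)) := by
    intro a ha y
    refine tendsto_nhdsWithin_iff.mpr ⟨?_, ?_⟩
    · exact ((continuous_const_mul a).tendsto y).mono_left nhdsWithin_le_nhds
    · filter_upwards [self_mem_nhdsWithin] with x hx hxy
      exact hx (mul_left_cancel₀ ha hxy)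
  have hne : ∀ y : ℂ, y ≠ 0 → ∀ᶠ x in 𝓝[≠] y, x ≠ 0 := fun y hy =>
    nhdsWithin_le_nhds (isOpen_ne.mem_nhds hy)
  constructor
  · rintro ⟨g, hg, hhg⟩
    refine ⟨fun x => l⁻¹ * g (q * x), analyticAt_const.mul
      (AnalyticAt.fun_comp hg (analyticAt_const.mul analyticAt_id)), ?_⟩
    filter_upwards [(key _ hq' z).eventually hhg, hne z hz] with x hx hx0
    rw [← hx, hs x hx0, inv_mul_cancel_left₀ hl]
  · rintro ⟨g, hg, hhg⟩
    have e : (q : ℂ)⁻¹ * (q * z) = z := inv_mul_cancel_left₀ hq' z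
    have hqz : (q : ℂ) * z ≠ 0 := mul_ne_zero hq' hz
    have k := key _ (inv_ne_zero hq') (q * z)
    rw [e] at k
    refine ⟨fun x => l * g ((q : ℂ)⁻¹ * x), analyticAt_const.mul
      (AnalyticAt.fun_comp (by rw [e]; exact hg) (analyticAt_const.mul analyticAt_id)), ?_⟩
    filter_upwards [k.eventually hhg, hne _ hqz] with x hx hx0
    rw [← hx, ← hs _ (mul_ne_zero (inv_ne_zero hq') hx0), mul_inv_cancel_left₀ hq']

lemma analyticAt_dslope {f : ℂ → ℂ} {c : ℂ} (hf : AnalyticAt ℂ f c) :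
    AnalyticAt ℂ (dslope f c) c := by
  have h1 : {z | AnalyticAt ℂ f z} ∈ 𝓝 c := hf.eventually_analyticAt
  have h2 : DifferentiableOn ℂ f {z | AnalyticAt ℂ f z} := fun z hz =>
    AnalyticAt.differentiableWithinAt hz
  exact ((Complex.differentiableOn_dslope h1).mpr h2).analyticAt h1

/-- The Kronecker formula
`∑_{m ∈ ℤ} w^m / (1 - z q^m) = (q; q)_∞² θ_q(zw) / (θ_q(w) θ_q(z))` for `q < |w| < 1`. -/
theorem tsum_kronecker {q : ℝ} (hq : 0 < q ∧ q < 1) {w z : ℂ} (h1 : q < ‖w‖) (h2 : ‖w‖ < 1)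
    (hz : z ≠ 0) (hzq : theta q z ≠ 0) :
    ∑' m : ℤ, w ^ m / (1 - z * (q : ℂ) ^ m) =
      qPoch q q ^ 2 * theta q (z * w) / (theta q w * theta q z) := by
  have hq' := ofReal_ne_zero_of_pos hq.1
  have hw : w ≠ 0 := norm_pos_iff.mp (hq.1.trans h1)
  have hθw := theta_ne_zero_of_norm hq h1 h2
  obtain ⟨h, hh⟩ : ∃ h : ℂ → ℂ, h = fun x => ∑' m : ℤ, w ^ m / (1 - x * (q : ℂ) ^ m) -
      qPoch q q ^ 2 * theta q (x * w) / (theta q w * theta q x) := ⟨_, rfl⟩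
  have hθan : ∀ x : ℂ, x ≠ 0 → AnalyticAt ℂ (fun x => qPoch q q ^ 2 * theta q (x * w)) x := by
    intro x hx
    exact analyticAt_const.mul (AnalyticAt.fun_comp (analyticAt_theta hq (mul_ne_zero hx hw))
      (analyticAt_id.mul analyticAt_const))
  have hreg : ∀ x : ℂ, x ≠ 0 → theta q x ≠ 0 → AnalyticAt ℂ h x := by
    intro x hx hθ
    rw [hh]
    refine AnalyticAt.sub ?_ ((hθan x hx).div (analyticAt_const.mul (analyticAt_theta hq hx))
      (mul_ne_zero hθw hθ))
    refine (analyticAt_tsum_kronecker hq h1 h2 hx).congr (Eventually.of_forall fun y => ?_)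
    refine tsum_congr fun m => if_neg fun hm => hθ ?_
    rw [theta_eq_zero_iff hq hx]
    exact ⟨-m, by rw [zpow_neg]; exact eq_inv_of_mul_eq_one_left hm⟩
  have hs : ∀ x : ℂ, x ≠ 0 → h (q * x) = w⁻¹ * h x := by
    intro x hx
    have e1 : ∑' m : ℤ, w ^ m / (1 - q * x * (q : ℂ) ^ m) =
        w⁻¹ * ∑' m : ℤ, w ^ m / (1 - x * (q : ℂ) ^ m) := by
      rw [← tsum_mul_left, ← (Equiv.addRight (1 : ℤ)).tsum_eq
        (fun m : ℤ => w⁻¹ * (w ^ m / (1 - x * (q : ℂ) ^ m)))]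
      refine tsum_congr fun m => ?_
      simp only [Equiv.coe_addRight]
      rw [zpow_add_one₀ hw, zpow_add_one₀ hq', mul_comm (w ^ m) w, mul_div_assoc,
        inv_mul_cancel_left₀ hw]
      congr 2; ring
    simp only [hh]
    rw [e1, mul_assoc, theta_q_mul hq hx, theta_q_mul hq (mul_ne_zero hx hw), mul_sub]
    congr 1
    -- At a zero of the denominator both quotients are `0` by convention, so the functional equation
    -- holds at every nonzero point.
    by_cases hθ : theta q x = 0
    · simp [hθ]
    · field_simp
  have hone : ∃ g : ℂ → ℂ, AnalyticAt ℂ g 1 ∧ h =ᶠ[𝓝[≠] 1] g := by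
    -- Near `1` the theta quotient is `k(x) / (1 - x)` with `k(1) = 1`, and the term `m = 0` of the
    -- series is `1 / (1 - x)`. Their difference is the difference quotient of `k` at `1`, so the
    -- poles cancel.
    obtain ⟨k, hk⟩ : ∃ k : ℂ → ℂ, k = fun x => qPoch q q ^ 2 * theta q (x * w) /
      (theta q w * thetaReg q x) := ⟨_, rfl⟩
    have hreg1 : AnalyticAt ℂ (thetaReg q) 1 :=
      DifferentiableOn.analyticAt (s := {0}ᶜ) (fun x hx =>
        (differentiableAt_thetaReg hq hx).differentiableWithinAt)
        (isOpen_compl_singleton.mem_nhds one_ne_zero)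
    have hka : AnalyticAt ℂ k 1 := by
      rw [hk]
      exact (hθan 1 one_ne_zero).div (analyticAt_const.mul hreg1)
        (mul_ne_zero hθw (thetaReg_one_ne_zero hq))
    have hk1 : k 1 = 1 := by
      have := qPoch_self_ne_zero hq
      rw [hk]; simp only [one_mul, thetaReg_one]
      field_simp
    refine ⟨_, (analyticAt_tsum_kronecker hq h1 h2 one_ne_zero).add (analyticAt_dslope hka), ?_⟩
    have hne0 : ∀ᶠ x : ℂ in 𝓝[≠] 1, x ≠ 0 := nhdsWithin_le_nhds (isOpen_ne.mem_nhds one_ne_zero)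
    filter_upwards [self_mem_nhdsWithin, hne0] with x hx hx0
    have hx1 : x ≠ 1 := hx
    have e0 : ∀ m : ℤ, (1 : ℂ) * (q : ℂ) ^ m = 1 ↔ m = 0 := by
      intro m
      rw [one_mul]
      constructor
      · intro hm
        have : q ^ m = 1 := by exact_mod_cast hm
        exact (zpow_eq_one_iff_right₀ hq.1.le hq.2.ne).mp this
      · rintro rfl; simp
    have hx2 : 1 - x ≠ 0 := sub_ne_zero.mpr hx1.symm
    have hx3 : x - 1 ≠ 0 := sub_ne_zero.mpr hx1
    simp only [hh, e0, Pi.add_apply]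
    rw [(summable_kronecker hq h1 h2 hx0).tsum_eq_add_tsum_ite 0, dslope_of_ne _ hx1,
      slope_def_field, hk1, hk, theta_eq_mul_thetaReg hq x]
    simp only [zpow_zero, mul_one]
    have e4 : qPoch q q ^ 2 * theta q (x * w) / (theta q w * ((1 - x) * thetaReg q x)) =
      qPoch q q ^ 2 * theta q (x * w) / (theta q w * thetaReg q x) / (1 - x) := by
      rw [div_div]; ring_nf
    rw [e4]
    field_simp
    ring
  have hext : ∀ x : ℂ, x ≠ 0 → ∃ g : ℂ → ℂ, AnalyticAt ℂ g x ∧ h =ᶠ[𝓝[≠] x] g := by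
    intro x hx
    by_cases hθ : theta q x = 0
    · obtain ⟨k, rfl⟩ := (theta_eq_zero_iff hq hx).mp hθ
      have := (zpow_mul_iff_of_mul_iff hq
        (p := fun x => ∃ g : ℂ → ℂ, AnalyticAt ℂ g x ∧ h =ᶠ[𝓝[≠] x] g)
        (fun y hy => removable_q_mul_iff hq (inv_ne_zero hw) hs hy) k one_ne_zero).mpr hone
      simpa using this
    · exact ⟨h, hreg x hx hθ, EventuallyEq.rfl⟩
  have h0 := eq_zero_of_q_shift_of_removable hq (l := w⁻¹)
    (by rw [norm_inv]; exact (one_lt_inv₀ (hq.1.trans h1)).mpr h2)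
    (by rw [norm_inv]; exact (inv_lt_inv₀ (hq.1.trans h1) hq.1).mpr h1)
    hext hs hz (hreg z hz hzq).continuousAt
  rw [hh] at h0
  exact sub_eq_zero.mp h0

/-! ### The three-term relation for theta functions -/

lemma theta_one {q : ℝ} (hq : 0 < q ∧ q < 1) : theta q 1 = 0 := by
  rw [theta_eq_mul_thetaReg hq]; simp

lemma analyticAt_theta_mul {q : ℝ} (hq : 0 < q ∧ q < 1) {a x : ℂ} (ha : a ≠ 0) (hx : x ≠ 0) :
    AnalyticAt ℂ (fun x => theta q (x * a)) x :=
  AnalyticAt.fun_comp (analyticAt_theta hq (mul_ne_zero hx ha)) (analyticAt_id.mul analyticAt_const)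

/-- The zero of `θ(x/a)` at `x = a` is simple, with cofactor `thetaReg`, so a zero of `f` at `a`
cancels it. -/
lemma exists_analyticAt_div_theta {q : ℝ} (hq : 0 < q ∧ q < 1) {f : ℂ → ℂ} {a : ℂ} (ha : a ≠ 0)
    (hf : AnalyticAt ℂ f a) (hfa : f a = 0) :
    ∃ g : ℂ → ℂ, AnalyticAt ℂ g a ∧ (fun x => f x / theta q (x * a⁻¹)) =ᶠ[𝓝[≠] a] g := by
  have hreg : AnalyticAt ℂ (thetaReg q) 1 :=
    DifferentiableOn.analyticAt (s := {0}ᶜ) (fun x hx =>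
      (differentiableAt_thetaReg hq hx).differentiableWithinAt)
      (isOpen_compl_singleton.mem_nhds one_ne_zero)
  have e : a * a⁻¹ = 1 := mul_inv_cancel₀ ha
  refine ⟨fun x => -a * dslope f a x / thetaReg q (x * a⁻¹),
    (analyticAt_const.mul (analyticAt_dslope hf)).div
      (AnalyticAt.fun_comp (by rw [e]; exact hreg) (analyticAt_id.mul analyticAt_const)) (by
        rw [e]; exact thetaReg_one_ne_zero hq), ?_⟩
  filter_upwards [self_mem_nhdsWithin] with x hx
  have hx1 : x - a ≠ 0 := sub_ne_zero.mpr hx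
  rw [dslope_of_ne _ hx, slope_def_field, hfa, theta_eq_mul_thetaReg hq, sub_zero]
  have e2 : (1 - x * a⁻¹) = -(x - a) * a⁻¹ := by
    rw [neg_sub, sub_mul, e]
  rw [e2, ← div_div]
  congr 1
  field_simp

/-- As functions of `x`, both sides have the same multiplier under `x ↦ qx`, and their difference
vanishes at `x = y` and `x = 1/δ`. Divided by `θ(x/y) θ(xδ)`, the difference has only removable
singularities and multiplier `1/(wu)`, hence is zero. The condition `θ(yδ) ≠ 0` keeps the two orbits
of zeros disjoint. -/
lemma theta_three_term {q : ℝ} (hq : 0 < q ∧ q < 1) {x y γ δ u v w : ℂ} (hx : x ≠ 0) (hy : y ≠ 0)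
    (hγ : γ ≠ 0) (hδ : δ ≠ 0) (huv : u * v = q) (hud : u * δ = v * γ)
    (h1 : q < ‖w * u‖) (h2 : ‖w * u‖ < 1) (hyδ : theta q (y * δ) ≠ 0)
    (hxy : theta q (x * y⁻¹) ≠ 0) (hxδ : theta q (x * δ) ≠ 0) :
    theta q (x * δ) * theta q (y * γ) * theta q (x * y⁻¹ * (w * u)) * theta q (w * v) -
      theta q (x * γ) * theta q (y * δ) * theta q (x * y⁻¹ * (w * v)) * theta q (w * u) =
    δ * y * theta q (γ / δ) * theta q (y * (δ * u) / w) * theta q (x * y⁻¹) *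
      theta q (x * (w * (δ * u))) := by
  have hq' := ofReal_ne_zero_of_pos hq.1
  have hwu : w * u ≠ 0 := norm_pos_iff.mp (hq.1.trans h1)
  have hw : w ≠ 0 := left_ne_zero_of_mul hwu
  have hu : u ≠ 0 := right_ne_zero_of_mul hwu
  have hv : v ≠ 0 := right_ne_zero_of_mul (huv ▸ hq')
  have hyi : y⁻¹ ≠ 0 := inv_ne_zero hy
  obtain ⟨D, hD⟩ : ∃ D : ℂ → ℂ, D = fun x =>
    theta q (x * δ) * theta q (y * γ) * theta q (x * (y⁻¹ * (w * u))) * theta q (w * v) -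
      theta q (x * γ) * theta q (y * δ) * theta q (x * (y⁻¹ * (w * v))) * theta q (w * u) -
    δ * y * theta q (γ / δ) * theta q (y * (δ * u) / w) * theta q (x * y⁻¹) *
      theta q (x * (w * (δ * u))) := ⟨_, rfl⟩
  have hDan : ∀ x : ℂ, x ≠ 0 → AnalyticAt ℂ D x := by
    intro x hx
    rw [hD]
    have A : ∀ a : ℂ, a ≠ 0 → AnalyticAt ℂ (fun x => theta q (x * a)) x := fun a ha =>
      analyticAt_theta_mul hq ha hx
    have a1 := A δ hδ
    have a2 := A (y⁻¹ * (w * u)) (by positivity)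
    have a3 := A γ hγ
    have a4 := A (y⁻¹ * (w * v)) (by positivity)
    have a5 := A y⁻¹ hyi
    have a6 := A (w * (δ * u)) (by positivity)
    exact ((((a1.mul analyticAt_const).mul a2).mul analyticAt_const).sub
      (((a3.mul analyticAt_const).mul a4).mul analyticAt_const)).sub
      ((analyticAt_const.mul a5).mul a6)
  have hDy : D y = 0 := by
    simp only [hD]
    rw [mul_inv_cancel_left₀ hy, mul_inv_cancel_left₀ hy, mul_inv_cancel₀ hy, theta_one hq]
    ring
  have hDδ : D δ⁻¹ = 0 := by
    simp only [hD]
    -- Here `uv = q` enters: it makes this argument the reflection under `z ↦ q/z` of the argument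
    -- of a factor on the right-hand side.
    have e1 : δ⁻¹ * (y⁻¹ * (w * v)) = q / (y * (δ * u) / w) := by
      rw [← huv]; field_simp
    have e2 : δ⁻¹ * y⁻¹ = (y * δ)⁻¹ := by rw [mul_inv]; ring
    have e3 : δ⁻¹ * (w * (δ * u)) = w * u := by field_simp
    have e4 : δ⁻¹ * γ = γ / δ := by field_simp
    rw [e1, e2, e3, e4, inv_mul_cancel₀ hδ, theta_one hq, theta_q_div hq,
      theta_inv hq (mul_ne_zero hy hδ)]
    field_simp
    ring
  have hDs : ∀ x : ℂ, x ≠ 0 → D (q * x) = y / (x ^ 2 * (w * (δ * u))) * D x := by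
    intro x hx
    have A : ∀ a : ℂ, a ≠ 0 → theta q (q * x * a) = -(x * a)⁻¹ * theta q (x * a) := fun a ha => by
      rw [mul_assoc, theta_q_mul hq (mul_ne_zero hx ha)]
    simp only [hD]
    rw [A δ hδ, A (y⁻¹ * (w * u)) (by positivity), A γ hγ, A (y⁻¹ * (w * v)) (by positivity),
      A y⁻¹ hyi, A (w * (δ * u)) (by positivity)]
    have c1 : (x * δ)⁻¹ * (x * (y⁻¹ * (w * u)))⁻¹ = y / (x ^ 2 * (w * (δ * u))) := by field_simp
    -- Here `uδ = vγ` enters: it gives the second product the multiplier of the first.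
    have c2 : (x * γ)⁻¹ * (x * (y⁻¹ * (w * v)))⁻¹ = y / (x ^ 2 * (w * (δ * u))) := by
      rw [mul_comm δ u, hud]; field_simp
    have c3 : (x * y⁻¹)⁻¹ * (x * (w * (δ * u)))⁻¹ = y / (x ^ 2 * (w * (δ * u))) := by field_simp
    linear_combination (theta q (x * δ) * theta q (y * γ) * theta q (x * (y⁻¹ * (w * u))) *
      theta q (w * v)) * c1 - (theta q (x * γ) * theta q (y * δ) * theta q (x * (y⁻¹ * (w * v))) *
      theta q (w * u)) * c2 - (δ * y * theta q (γ / δ) * theta q (y * (δ * u) / w) *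
      theta q (x * y⁻¹) * theta q (x * (w * (δ * u)))) * c3
  obtain ⟨h, hh⟩ : ∃ h : ℂ → ℂ, h = fun x => D x / (theta q (x * y⁻¹) * theta q (x * δ)) := ⟨_, rfl⟩
  have hs : ∀ x : ℂ, x ≠ 0 → h (q * x) = (w * u)⁻¹ * h x := by
    intro x hx
    simp only [hh]
    rw [hDs x hx, mul_assoc (q : ℂ), mul_assoc (q : ℂ), theta_q_mul hq (mul_ne_zero hx hyi),
      theta_q_mul hq (mul_ne_zero hx hδ)]
    have e : -(x * y⁻¹)⁻¹ * theta q (x * y⁻¹) * (-(x * δ)⁻¹ * theta q (x * δ)) =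
      (y / (x ^ 2 * δ)) * (theta q (x * y⁻¹) * theta q (x * δ)) := by
      field_simp
    rw [e, mul_div_mul_comm]
    congr 1
    field_simp
  have hreg : ∀ x : ℂ, x ≠ 0 → theta q (x * y⁻¹) ≠ 0 → theta q (x * δ) ≠ 0 → AnalyticAt ℂ h x := by
    intro x hx h1 h2
    rw [hh]
    exact (hDan x hx).fun_div ((analyticAt_theta_mul hq hyi hx).mul (analyticAt_theta_mul hq hδ hx))
      (mul_ne_zero h1 h2)
  have hext : ∀ x : ℂ, x ≠ 0 → ∃ g : ℂ → ℂ, AnalyticAt ℂ g x ∧ h =ᶠ[𝓝[≠] x] g := by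
    intro x hx
    by_cases c1 : theta q (x * y⁻¹) = 0
    · obtain ⟨k, hk⟩ := (theta_eq_zero_iff hq (mul_ne_zero hx hyi)).mp c1
      have e : x = (q : ℂ) ^ k * y := by rw [← hk, inv_mul_cancel_right₀ hy]
      rw [e]
      refine (zpow_mul_iff_of_mul_iff hq
        (p := fun x => ∃ g : ℂ → ℂ, AnalyticAt ℂ g x ∧ h =ᶠ[𝓝[≠] x] g)
        (fun z hz => removable_q_mul_iff hq (inv_ne_zero hwu) hs hz) k hy).mpr ?_
      have := exists_analyticAt_div_theta hq hy
        (f := fun x => D x / theta q (x * δ))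
        ((hDan y hy).fun_div (analyticAt_theta_mul hq hδ hy) hyδ) (by simp [hDy])
      simpa only [hh, div_div, mul_comm] using this
    · by_cases c2 : theta q (x * δ) = 0
      · obtain ⟨k, hk⟩ := (theta_eq_zero_iff hq (mul_ne_zero hx hδ)).mp c2
        have e : x = (q : ℂ) ^ k * δ⁻¹ := by rw [← hk, mul_inv_cancel_right₀ hδ]
        have hδi := inv_ne_zero hδ
        rw [e]
        refine (zpow_mul_iff_of_mul_iff hq
          (p := fun x => ∃ g : ℂ → ℂ, AnalyticAt ℂ g x ∧ h =ᶠ[𝓝[≠] x] g)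
          (fun z hz => removable_q_mul_iff hq (inv_ne_zero hwu) hs hz) k hδi).mpr ?_
        have hne : theta q (δ⁻¹ * y⁻¹) ≠ 0 := by
          rw [← mul_inv, mul_comm, theta_inv hq (mul_ne_zero hy hδ)]
          exact mul_ne_zero (neg_ne_zero.mpr (inv_ne_zero (mul_ne_zero hy hδ))) hyδ
        have := exists_analyticAt_div_theta hq hδi
          (f := fun x => D x / theta q (x * y⁻¹))
          ((hDan _ hδi).fun_div (analyticAt_theta_mul hq hyi hδi) hne) (by simp [hDδ])
        simpa only [hh, div_div, inv_inv] using this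
      · exact ⟨h, hreg x hx c1 c2, EventuallyEq.rfl⟩
  have h0 := eq_zero_of_q_shift_of_removable hq (l := (w * u)⁻¹)
    (by rw [norm_inv]; exact (one_lt_inv₀ (hq.1.trans h1)).mpr h2)
    (by rw [norm_inv]; exact (inv_lt_inv₀ (hq.1.trans h1) hq.1).mpr h1)
    hext hs hx (hreg x hx hxy hxδ).continuousAt
  rw [hh] at h0
  have h3 : D x = 0 := (div_eq_zero_iff.mp h0).resolve_right (mul_ne_zero hxy hxδ)
  simp only [hD, ← mul_assoc] at h3
  simp only [← mul_assoc]
  exact sub_eq_zero.mp h3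

/-! ### Fourier series of the kernel, up to normalisation -/

/-- The numerator of the normalised kernel at the points `x q^m` and `y`. -/
def coreNum (q : ℝ) (γ δ u v x y : ℂ) (m : ℤ) : ℂ :=
  theta q (x * δ) * theta q (y * γ) * u ^ m - theta q (x * γ) * theta q (y * δ) * v ^ m

open Classical in
/-- The normalised kernel at the points `x q^m` and `y`. -/
def core (q : ℝ) (γ δ u v x y : ℂ) (m : ℤ) : ℂ :=
  if x = y ∧ m = 0 then
    δ * deriv (theta q) (y * δ) * theta q (y * γ) - γ * deriv (theta q) (y * γ) * theta q (y * δ)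
  else coreNum q γ δ u v x y m / (x * (q : ℂ) ^ m - y)

/-- The sum of the Fourier series of `core`. -/
def coreSum (q : ℝ) (γ δ u v x y w : ℂ) : ℂ :=
  -(δ * qPoch q q ^ 2 * theta q (γ / δ) * theta q (x * (w * (δ * u))) *
    theta q (y * (δ * u) / w) / (theta q (w * u) * theta q (w * v)))

lemma ne_of_theta_ne_zero {q : ℝ} (hq : 0 < q ∧ q < 1) {x y : ℂ} (hy : y ≠ 0)
    (h : theta q (x * y⁻¹) ≠ 0) (m : ℤ) : x * (q : ℂ) ^ m - y ≠ 0 := by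
  intro h0
  have hq' := ofReal_ne_zero_of_pos hq.1
  have hqm : (q : ℂ) ^ m ≠ 0 := zpow_ne_zero _ hq'
  have e : x * y⁻¹ = (q : ℂ) ^ (-m) := by
    rw [zpow_neg, ← sub_eq_zero.mp h0]
    by_cases hx : x = 0
    · rw [hx, zero_mul] at h0
      exact absurd (sub_eq_zero.mp h0).symm hy
    · field_simp
  apply h
  rw [theta_eq_zero_iff hq (by rw [e]; exact zpow_ne_zero _ hq')]
  exact ⟨-m, e⟩

lemma hasSum_kronecker {q : ℝ} (hq : 0 < q ∧ q < 1) {w u x y : ℂ} (h1 : q < ‖w * u‖)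
    (h2 : ‖w * u‖ < 1) (hx : x ≠ 0) (hy : y ≠ 0) (hxy : theta q (x * y⁻¹) ≠ 0) :
    HasSum (fun m : ℤ => w ^ m * (u ^ m / (x * (q : ℂ) ^ m - y)))
      (-y⁻¹ * (qPoch q q ^ 2 * theta q (x * y⁻¹ * (w * u)) /
        (theta q (w * u) * theta q (x * y⁻¹)))) := by
  have hz : x * y⁻¹ ≠ 0 := mul_ne_zero hx (inv_ne_zero hy)
  rw [← tsum_kronecker hq h1 h2 hz hxy]
  refine ((summable_kronecker hq h1 h2 hz).hasSum.mul_left (-y⁻¹)).congr_fun fun m => ?_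
  have e : (1 - x * y⁻¹ * (q : ℂ) ^ m) = -y⁻¹ * (x * (q : ℂ) ^ m - y) := by
    field_simp
    ring
  have := ne_of_theta_ne_zero hq hy hxy m
  rw [e, mul_zpow]
  field_simp

/-- The two Kronecker sums, over a common denominator, have the left-hand side of `theta_three_term`
as numerator; the factor `θ(x/y)` on its right-hand side cancels their denominator. -/
lemma hasSum_coreNum {q : ℝ} (hq : 0 < q ∧ q < 1) {x y γ δ u v w : ℂ} (hx : x ≠ 0) (hy : y ≠ 0)
    (hγ : γ ≠ 0) (hδ : δ ≠ 0) (huv : u * v = q) (hud : u * δ = v * γ)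
    (hu1 : q < ‖w * u‖) (hu2 : ‖w * u‖ < 1) (hv1 : q < ‖w * v‖) (hv2 : ‖w * v‖ < 1)
    (hyδ : theta q (y * δ) ≠ 0)
    (hxy : theta q (x * y⁻¹) ≠ 0) (hxδ : theta q (x * δ) ≠ 0) :
    HasSum (fun m : ℤ => w ^ m * (coreNum q γ δ u v x y m / (x * (q : ℂ) ^ m - y)))
      (coreSum q γ δ u v x y w) := by
  have k1 := (hasSum_kronecker hq hu1 hu2 hx hy hxy).mul_left (theta q (x * δ) * theta q (y * γ))
  have k2 := (hasSum_kronecker hq hv1 hv2 hx hy hxy).mul_left (theta q (x * γ) * theta q (y * δ))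
  have t := theta_three_term hq hx hy hγ hδ huv hud hu1 hu2 hyδ hxy hxδ
  have n1 := theta_ne_zero_of_norm hq hu1 hu2
  have n2 := theta_ne_zero_of_norm hq hv1 hv2
  convert! k1.sub k2 using 1
  · funext m
    rw [coreNum]
    ring
  · have : coreSum q γ δ u v x y w = -y⁻¹ * qPoch q q ^ 2 /
        (theta q (w * u) * theta q (w * v) * theta q (x * y⁻¹)) *
        (δ * y * theta q (γ / δ) * theta q (y * (δ * u) / w) * theta q (x * y⁻¹) *
          theta q (x * (w * (δ * u)))) := by
      rw [coreSum]
      generalize theta q (x * y⁻¹) = T at hxy ⊢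
      generalize theta q (y * (δ * u) / w) = T'
      field_simp
    rw [this, ← t]
    generalize theta q (x * y⁻¹) = T at hxy ⊢
    generalize theta q (x * y⁻¹ * (w * u)) = T₁
    generalize theta q (x * y⁻¹ * (w * v)) = T₂
    field_simp
    ring

lemma theta_eventually_ne_zero {q : ℝ} (hq : 0 < q ∧ q < 1) {f : ℂ → ℂ} {a : ℂ}
    (hf : ContinuousAt f a) (h0 : f a ≠ 0) (h : theta q (f a) ≠ 0) :
    ∀ᶠ x in 𝓝 a, theta q (f x) ≠ 0 :=
  (ContinuousAt.comp' (differentiableAt_theta hq h0).continuousAt hf).eventually_ne h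

lemma theta_mul_inv_eventually_ne_zero {q : ℝ} (hq : 0 < q ∧ q < 1) {y : ℂ} (hy : y ≠ 0) :
    ∀ᶠ x in 𝓝 y, x ≠ y → theta q (x * y⁻¹) ≠ 0 := by
  have e : y * y⁻¹ = 1 := mul_inv_cancel₀ hy
  have hc : ContinuousAt (fun x => thetaReg q (x * y⁻¹)) y := by
    refine ContinuousAt.comp' (g := thetaReg q) ?_ (by fun_prop)
    rw [e]
    exact (differentiableAt_thetaReg hq one_ne_zero).continuousAt
  have h1 := hc.eventually_ne (y := 0) (by rw [e]; exact thetaReg_one_ne_zero hq)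
  filter_upwards [h1] with x hx hxy
  rw [theta_eq_mul_thetaReg hq]
  refine mul_ne_zero (sub_ne_zero.mpr fun h => hxy ?_) hx
  exact ((mul_inv_eq_one₀ hy).mp h.symm)

/-- A series of functions, differentiable near `a` and dominated except for the term `0`, can be
differentiated termwise at `a`. -/
lemma hasSum_deriv_of_dominated {F : ℤ → ℂ → ℂ} {a : ℂ} {b : ℤ → ℝ} (hb : Summable b)
    {U : Set ℂ} (hU : U ∈ 𝓝 a) (hd : ∀ m, ∀ x ∈ U, DifferentiableAt ℂ (F m) x)
    (hle : ∀ m, m ≠ 0 → ∀ x ∈ U, ‖F m x‖ ≤ b m) :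
    HasSum (fun m => deriv (F m) a) (deriv (fun x => ∑' m, F m x) a) := by
  have ha : a ∈ U := mem_of_mem_nhds hU
  have h0 : ∀ᶠ x in 𝓝 a, ‖F 0 x‖ < ‖F 0 a‖ + 1 :=
    (hd 0 a ha).continuousAt.norm.eventually_lt_const (lt_add_one _)
  obtain ⟨V, hV, hVo, haV⟩ := eventually_nhds_iff.mp (h0.and hU)
  -- The term `0` needs no global bound: by continuity it is bounded near `a`, and changing one term
  -- of the majorant does not affect summability.
  have hb' : Summable (Function.update b 0 (‖F 0 a‖ + 1)) := hb.update _ _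
  refine Complex.hasSum_deriv_of_summable_norm hb' (fun m x hx =>
    (hd m x (hV x hx).2).differentiableWithinAt) hVo (fun m x hx => ?_) haV
  by_cases hm : m = 0
  · subst hm
    simpa using (hV x hx).1.le
  · rw [Function.update_of_ne hm]
    exact hle m hm x (hV x hx).2

lemma differentiableAt_coreSum_left {q : ℝ} (hq : 0 < q ∧ q < 1) {y γ δ u v w : ℂ} (hy : y ≠ 0)
    (hδ : δ ≠ 0) (hu : u ≠ 0) (hw : w ≠ 0) :
    DifferentiableAt ℂ (fun x => coreSum q γ δ u v x y w) y := by
  unfold coreSum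
  have h := (analyticAt_theta_mul hq (a := w * (δ * u)) (by positivity) hy).differentiableAt
  fun_prop

/-- The identity for `x ≠ y` is multiplied by `x - y` and differentiated at `x = y`. On the right
this returns `coreSum` at `y`, and on the left the terms of the diagonal series. -/
lemma hasSum_core_diag {q : ℝ} (hq : 0 < q ∧ q < 1) {y γ δ u v w : ℂ} (hy : y ≠ 0)
    (hγ : γ ≠ 0) (hδ : δ ≠ 0) (huv : u * v = q) (hud : u * δ = v * γ)
    (hu1 : q < ‖w * u‖) (hu2 : ‖w * u‖ < 1) (hv1 : q < ‖w * v‖) (hv2 : ‖w * v‖ < 1)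
    (hyδ : theta q (y * δ) ≠ 0) :
    HasSum (fun m : ℤ => w ^ m * core q γ δ u v y y m) (coreSum q γ δ u v y y w) := by
  have hwu : w * u ≠ 0 := norm_pos_iff.mp (hq.1.trans hu1)
  have hw : w ≠ 0 := left_ne_zero_of_mul hwu
  have hu : u ≠ 0 := right_ne_zero_of_mul hwu
  have e1 : y * y⁻¹ = 1 := mul_inv_cancel₀ hy
  -- For `m = 0` the factor `x - y` has been cancelled in advance, so the derivative at `y` is the
  -- Wronskian value of `core`. For `m ≠ 0` the factor `x - y` vanishes at `y`, so the derivative is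
  -- the term itself.
  obtain ⟨F, hF⟩ : ∃ F : ℤ → ℂ → ℂ, F = fun m x => if m = 0 then coreNum q γ δ u v x y 0
    else (x - y) * (w ^ m * (coreNum q γ δ u v x y m / (x * (q : ℂ) ^ m - y))) := ⟨_, rfl⟩
  have hθd : ∀ a : ℂ, a ≠ 0 → ∀ x : ℂ, x ≠ 0 → DifferentiableAt ℂ (fun x => theta q (x * a)) x :=
    fun a ha x hx => (analyticAt_theta_mul hq ha hx).differentiableAt
  have hnum : ∀ m, ∀ x : ℂ, x ≠ 0 → DifferentiableAt ℂ (fun x => coreNum q γ δ u v x y m) x := by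
    intro m x hx
    unfold coreNum
    have := hθd δ hδ x hx
    have := hθd γ hγ x hx
    fun_prop
  obtain ⟨c, hc, hcb⟩ := exists_le_norm_one_sub_near hq one_ne_zero
  have hden : ∀ x : ℂ, x * y⁻¹ ∈ Metric.ball (1 : ℂ) c → ∀ m : ℤ, m ≠ 0 →
      ‖y‖ * (c * (1 + q ^ m)) ≤ ‖x * (q : ℂ) ^ m - y‖ := by
    intro x hx m hm
    have h1 : (1 : ℂ) * (q : ℂ) ^ m ≠ 1 := by
      rw [one_mul]
      intro h
      have : q ^ m = 1 := by exact_mod_cast h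
      exact hm ((zpow_eq_one_iff_right₀ hq.1.le hq.2.ne).mp this)
    have e : x * (q : ℂ) ^ m - y = -y * (1 - x * y⁻¹ * (q : ℂ) ^ m) := by
      field_simp
      ring
    rw [e, norm_mul, norm_neg]
    exact mul_le_mul_of_nonneg_left (hcb _ hx m h1) (norm_nonneg _)
  have hball : ∀ᶠ x in 𝓝 y, x * y⁻¹ ∈ Metric.ball (1 : ℂ) c := by
    have : ContinuousAt (fun x => x * y⁻¹) y := by fun_prop
    exact this.eventually_mem (by rw [e1]; exact Metric.ball_mem_nhds 1 hc)
  obtain ⟨A, hA⟩ : ∃ A : ℝ, ∀ᶠ x in 𝓝 y, ‖theta q (x * δ) * theta q (y * γ)‖ < A :=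
    ⟨_, ((hθd δ hδ y hy).mul_const _).continuousAt.norm.eventually_lt_const (lt_add_one _)⟩
  obtain ⟨B, hB⟩ : ∃ B : ℝ, ∀ᶠ x in 𝓝 y, ‖theta q (x * γ) * theta q (y * δ)‖ < B :=
    ⟨_, ((hθd γ hγ y hy).mul_const _).continuousAt.norm.eventually_lt_const (lt_add_one _)⟩
  have hnear : ∀ᶠ x in 𝓝 y, ‖x - y‖ < 1 := by
    have : ContinuousAt (fun x => ‖x - y‖) y := by fun_prop
    exact this.eventually_lt_const (by simp)
  have hne := isOpen_ne.mem_nhds hy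
  have hy' := norm_pos_iff.mpr hy
  have hsum := (((summable_int_zpow_div hq hu1 hu2).mul_left (A / (‖y‖ * c))).add
    ((summable_int_zpow_div hq hv1 hv2).mul_left (B / (‖y‖ * c))))
  have key := hasSum_deriv_of_dominated (F := F) (a := y) hsum
    (((hA.and hB).and (hnear.and hne)).and hball) (fun m x hx => ?_) (fun m hm x hx => ?_)
  · have hderiv : ∀ m, deriv (F m) y = w ^ m * core q γ δ u v y y m := by
      intro m
      by_cases hm : m = 0
      · subst hm
        simp only [hF, core, if_true, coreNum, and_self, zpow_zero, mul_one, one_mul]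
        have d1 : ∀ a : ℂ, a ≠ 0 → HasDerivAt (fun x => theta q (x * a))
            (a * deriv (theta q) (y * a)) y := by
          intro a ha
          have h1 := (differentiableAt_theta hq (mul_ne_zero hy ha)).hasDerivAt
          have h2 : HasDerivAt (fun x : ℂ => x * a) a y := by
            simpa using (hasDerivAt_id y).mul_const a
          have := HasDerivAt.comp y h1 h2
          rwa [mul_comm] at this
        exact (((d1 δ hδ).mul_const _).sub ((d1 γ hγ).mul_const _)).deriv
      · simp only [hF, core, hm, and_false, if_false]
        have hd0 : y * (q : ℂ) ^ m - y ≠ 0 := by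
          have := hden y hball.self_of_nhds m hm
          have hp := zpow_pos hq.1 m
          exact norm_pos_iff.mp (lt_of_lt_of_le (by positivity) this)
        have hg : DifferentiableAt ℂ (fun x =>
            w ^ m * (coreNum q γ δ u v x y m / (x * (q : ℂ) ^ m - y))) y := by
          have h1 := hnum m y hy
          have h2 : DifferentiableAt ℂ (fun x : ℂ => x * (q : ℂ) ^ m - y) y := by fun_prop
          exact (h1.fun_div h2 hd0).const_mul _
        have := ((hasDerivAt_id y).sub_const y).fun_mul hg.hasDerivAt
        simpa using this.deriv
    have hts : (fun x => ∑' m, F m x) =ᶠ[𝓝 y] fun x => (x - y) * coreSum q γ δ u v x y w := by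
      filter_upwards [theta_mul_inv_eventually_ne_zero hq hy, hne,
        theta_eventually_ne_zero hq (f := fun x => x * δ) (by fun_prop) (mul_ne_zero hy hδ) hyδ]
        with x hx hx0 hxδ
      by_cases hxy : x = y
      · subst hxy
        rw [sub_self, zero_mul]
        refine (tsum_congr fun m => ?_).trans tsum_zero
        simp only [hF, sub_self, zero_mul, coreNum]
        split_ifs
        · simp; ring
        · rfl
      · have hs := hasSum_coreNum hq hx0 hy hγ hδ huv hud hu1 hu2 hv1 hv2 hyδ (hx hxy) hxδ
        rw [← hs.tsum_eq, ← tsum_mul_left]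
        refine tsum_congr fun m => ?_
        simp only [hF]
        split_ifs with hm
        · subst hm
          have : x - y ≠ 0 := sub_ne_zero.mpr hxy
          simp only [zpow_zero, mul_one, one_mul]
          field_simp
        · rfl
    have hR : deriv (fun x => ∑' m, F m x) y = coreSum q γ δ u v y y w := by
      rw [hts.deriv_eq]
      have := ((hasDerivAt_id y).sub_const y).fun_mul
        (differentiableAt_coreSum_left hq (γ := γ) (v := v) hy hδ hu hw).hasDerivAt
      simpa using this.deriv
    rw [hR] at key
    simpa only [hderiv] using key
  · obtain ⟨⟨⟨-, -⟩, -, hx0⟩, hxb⟩ := hx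
    simp only [hF]
    split_ifs with hm
    · exact hnum 0 x hx0
    · have hd0 : x * (q : ℂ) ^ m - y ≠ 0 := by
        have := hden x hxb m hm
        have hp := zpow_pos hq.1 m
        exact norm_pos_iff.mp (lt_of_lt_of_le (by positivity) this)
      have h2 : DifferentiableAt ℂ (fun x : ℂ => x * (q : ℂ) ^ m - y) x := by fun_prop
      have h3 : DifferentiableAt ℂ (fun x : ℂ => x - y) x := by fun_prop
      exact h3.fun_mul (((hnum m x hx0).fun_div h2 hd0).const_mul _)
  · obtain ⟨⟨⟨hxA, hxB⟩, hx1, hx0⟩, hxb⟩ := hx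
    have hp := zpow_pos hq.1 m
    have hpu : 0 < ‖w * u‖ ^ m := zpow_pos (hq.1.trans hu1) m
    have hpv : 0 < ‖w * v‖ ^ m := zpow_pos (hq.1.trans hv1) m
    have hd := hden x hxb m hm
    have hd' : 0 < ‖y‖ * (c * (1 + q ^ m)) := by positivity
    simp only [hF, if_neg hm]
    have e2 : w ^ m * (coreNum q γ δ u v x y m / (x * (q : ℂ) ^ m - y)) =
        (theta q (x * δ) * theta q (y * γ) * (w * u) ^ m -
          theta q (x * γ) * theta q (y * δ) * (w * v) ^ m) / (x * (q : ℂ) ^ m - y) := by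
      rw [coreNum, mul_zpow, mul_zpow]; ring
    rw [e2, norm_mul, norm_div]
    have hn : ‖theta q (x * δ) * theta q (y * γ) * (w * u) ^ m -
          theta q (x * γ) * theta q (y * δ) * (w * v) ^ m‖ ≤
        A * ‖w * u‖ ^ m + B * ‖w * v‖ ^ m := by
      refine (norm_sub_le _ _).trans ?_
      rw [norm_mul _ ((w * u) ^ m), norm_mul _ ((w * v) ^ m), norm_zpow, norm_zpow]
      gcongr
    have hnn : 0 ≤ A * ‖w * u‖ ^ m + B * ‖w * v‖ ^ m := (norm_nonneg _).trans hn
    calc _ ≤ 1 * ((A * ‖w * u‖ ^ m + B * ‖w * v‖ ^ m) / (‖y‖ * (c * (1 + q ^ m)))) := by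
          gcongr
      _ = _ := by field_simp

lemma hasSum_core {q : ℝ} (hq : 0 < q ∧ q < 1) {x y γ δ u v w : ℂ} (hx : x ≠ 0) (hy : y ≠ 0)
    (hγ : γ ≠ 0) (hδ : δ ≠ 0) (huv : u * v = q) (hud : u * δ = v * γ)
    (hu1 : q < ‖w * u‖) (hu2 : ‖w * u‖ < 1) (hv1 : q < ‖w * v‖) (hv2 : ‖w * v‖ < 1)
    (hyδ : theta q (y * δ) ≠ 0) (hxδ : theta q (x * δ) ≠ 0)
    (hxy : x = y ∨ theta q (x * y⁻¹) ≠ 0) :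
    HasSum (fun m : ℤ => w ^ m * core q γ δ u v x y m) (coreSum q γ δ u v x y w) := by
  rcases hxy with rfl | hxy
  · exact hasSum_core_diag hq hx hγ hδ huv hud hu1 hu2 hv1 hv2 hyδ
  · have hne : x ≠ y := by
      rintro rfl
      rw [mul_inv_cancel₀ hx] at hxy
      exact hxy (theta_one hq)
    simpa only [core, hne, false_and, if_false] using
      hasSum_coreNum hq hx hy hγ hδ huv hud hu1 hu2 hv1 hv2 hyδ hxy hxδ

/-! ### The confluent case -/

lemma differentiableAt_theta_comp {q : ℝ} (hq : 0 < q ∧ q < 1) {f : ℂ → ℂ} {r : ℂ}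
    (hf : DifferentiableAt ℂ f r) (h0 : f r ≠ 0) : DifferentiableAt ℂ (fun r => theta q (f r)) r :=
  DifferentiableAt.fun_comp' r (differentiableAt_theta hq h0) hf

/-- The normalised kernel for `δ = γ / r²`. -/
def confluentCore (q : ℝ) (γ a x y : ℂ) (m : ℤ) (r : ℂ) : ℂ :=
  core q γ (γ / r ^ 2) (a * r) (a / r) x y m

lemma differentiableAt_confluentCore {q : ℝ} (hq : 0 < q ∧ q < 1) {γ a x y r : ℂ} (hγ : γ ≠ 0)
    (ha : a ≠ 0) (hx : x ≠ 0) (hy : y ≠ 0) (hr : r ≠ 0) (m : ℤ) :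
    DifferentiableAt ℂ (confluentCore q γ a x y m) r := by
  have hδ : DifferentiableAt ℂ (fun r : ℂ => γ / r ^ 2) r :=
    (differentiableAt_const _).fun_div (by fun_prop) (pow_ne_zero 2 hr)
  have hδ0 : γ / r ^ 2 ≠ 0 := div_ne_zero hγ (pow_ne_zero 2 hr)
  have hyδ := differentiableAt_theta_comp hq (hδ.const_mul y) (mul_ne_zero hy hδ0)
  have hxδ := differentiableAt_theta_comp hq (hδ.const_mul x) (mul_ne_zero hx hδ0)
  unfold confluentCore core coreNum
  by_cases h : x = y ∧ m = 0
  · simp only [if_pos h]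
    have hd : DifferentiableAt ℂ (fun r => deriv (theta q) (y * (γ / r ^ 2))) r :=
      DifferentiableAt.fun_comp' r (differentiableAt_deriv_theta hq (mul_ne_zero hy hδ0))
        (hδ.const_mul y)
    exact (((hδ.fun_mul hd).mul_const _)).fun_sub (hyδ.const_mul _)
  · simp only [if_neg h]
    have h1 : DifferentiableAt ℂ (fun r : ℂ => (a * r) ^ m) r :=
      (differentiableAt_id.const_mul a).zpow (Or.inl (mul_ne_zero ha hr))
    have h2 : DifferentiableAt ℂ (fun r : ℂ => (a / r) ^ m) r :=
      ((differentiableAt_const a).fun_div differentiableAt_id hr).zpow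
        (Or.inl (div_ne_zero ha hr))
    exact (((hxδ.mul_const _).fun_mul h1).fun_sub ((hyδ.const_mul _).fun_mul h2)).div_const _

/-- With `δ = γ/r²`, `u = ar` and `v = a/r`, the constraints `uv = q` and `uδ = vγ` hold for every
`r ≠ 0`. The sum from `hasSum_core` has a factor `θ(r²)`, which vanishes at `r = 1`; differentiating
there extracts its cofactor. -/
lemma hasSum_deriv_confluentCore {q : ℝ} (hq : 0 < q ∧ q < 1) {x y γ a w : ℂ} (hx : x ≠ 0)
    (hy : y ≠ 0) (hγ : γ ≠ 0) (ha : a ^ 2 = q) (hw : ‖w‖ = 1)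
    (hyγ : theta q (y * γ) ≠ 0) (hxγ : theta q (x * γ) ≠ 0)
    (hxy : x = y ∨ theta q (x * y⁻¹) ≠ 0) :
    HasSum (fun m : ℤ => w ^ m * deriv (confluentCore q γ a x y m) 1)
      (2 * γ * qPoch q q ^ 4 * theta q (x * (w * (γ * a))) * theta q (y * (γ * a) / w) /
        (theta q (w * a) * theta q (w * a))) := by
  have hq' := ofReal_ne_zero_of_pos hq.1
  have ha0 : a ≠ 0 := by
    rintro rfl
    exact hq' (by rw [← ha]; simp)
  have hw0 : w ≠ 0 := norm_pos_iff.mp (by rw [hw]; exact one_pos)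
  have hna : ‖a‖ ^ 2 = q := by
    rw [← norm_pow, ha, Complex.norm_real, Real.norm_of_nonneg hq.1.le]
  have hna1 : q < ‖a‖ := by nlinarith [norm_nonneg a, hq.1, hq.2]
  have hna2 : ‖a‖ < 1 := by nlinarith [norm_nonneg a, hq.1, hq.2]
  -- For `r` near `1`, both `|ar|` and `|a/r|` stay in `(ρ₁, ρ₂)`, a subinterval of `(q, 1)`. Then
  -- `ρ₁^m + ρ₂^m` majorises their `m`-th powers for either sign of `m`.
  obtain ⟨ρ₁, hρ₁, hρ₁'⟩ := exists_between hna1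
  obtain ⟨ρ₂, hρ₂, hρ₂'⟩ := exists_between hna2
  have hρ₁0 : 0 < ρ₁ := hq.1.trans hρ₁
  have hρ₂0 : 0 < ρ₂ := (norm_nonneg a).trans_lt hρ₂
  obtain ⟨c, hc, hcb⟩ := exists_le_norm_one_sub hq (mul_ne_zero hx (inv_ne_zero hy))
  have hden : ∀ m : ℤ, m ≠ 0 → ‖y‖ * (c * (1 + q ^ m)) ≤ ‖x * (q : ℂ) ^ m - y‖ := by
    intro m hm
    have e : x * (q : ℂ) ^ m - y = -y * (1 - x * y⁻¹ * (q : ℂ) ^ m) := by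
      field_simp
      ring
    rw [e, norm_mul, norm_neg]
    refine mul_le_mul_of_nonneg_left (hcb m ?_) (norm_nonneg _)
    rcases hxy with rfl | hxy
    · rw [mul_inv_cancel₀ hx, one_mul]
      intro h
      have : q ^ m = 1 := by exact_mod_cast h
      exact hm ((zpow_eq_one_iff_right₀ hq.1.le hq.2.ne).mp this)
    · intro h
      rw [h, sub_self, mul_zero] at e
      exact ne_of_theta_ne_zero hq hy hxy m e
  have hδ : ∀ r : ℂ, r ≠ 0 → DifferentiableAt ℂ (fun r : ℂ => γ / r ^ 2) r := fun r hr =>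
    (differentiableAt_const _).fun_div (by fun_prop) (pow_ne_zero 2 hr)
  have hδ1 := hδ 1 one_ne_zero
  have e1 : γ / 1 ^ 2 = γ := by simp
  have hθδ : ∀ z : ℂ, z ≠ 0 → DifferentiableAt ℂ (fun r => theta q (z * (γ / r ^ 2))) 1 := by
    intro z hz
    exact differentiableAt_theta_comp hq (hδ1.const_mul z) (by rw [e1]; exact mul_ne_zero hz hγ)
  obtain ⟨A, hA⟩ : ∃ A : ℝ, ∀ᶠ r in 𝓝 (1 : ℂ), ‖theta q (x * (γ / r ^ 2)) * theta q (y * γ)‖ < A :=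
    ⟨_, ((hθδ x hx).mul_const _).continuousAt.norm.eventually_lt_const (lt_add_one _)⟩
  obtain ⟨B, hB⟩ : ∃ B : ℝ, ∀ᶠ r in 𝓝 (1 : ℂ), ‖theta q (x * γ) * theta q (y * (γ / r ^ 2))‖ < B :=
    ⟨_, ((hθδ y hy).const_mul _).continuousAt.norm.eventually_lt_const (lt_add_one _)⟩
  have hxne := (hθδ x hx).continuousAt.eventually_ne (y := 0) (by simpa using hxγ)
  have hyne := (hθδ y hy).continuousAt.eventually_ne (y := 0) (by simpa using hyγ)
  have hcu : ContinuousAt (fun r : ℂ => ‖a * r‖) 1 := by fun_prop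
  have hcv : ContinuousAt (fun r : ℂ => ‖a / r‖) 1 :=
    (continuousAt_const.div continuousAt_id one_ne_zero).norm
  have hu1 := hcu.eventually_const_lt (u := ρ₁) (by simpa using hρ₁')
  have hu2 := hcu.eventually_lt_const (u := ρ₂) (by simpa using hρ₂)
  have hv1 := hcv.eventually_const_lt (u := ρ₁) (by simpa using hρ₁')
  have hv2 := hcv.eventually_lt_const (u := ρ₂) (by simpa using hρ₂)
  have hne : ∀ᶠ r : ℂ in 𝓝 1, r ≠ 0 := isOpen_ne.mem_nhds one_ne_zero
  have hzpow : ∀ t : ℝ, ρ₁ < t → t < ρ₂ → ∀ m : ℤ, t ^ m ≤ ρ₁ ^ m + ρ₂ ^ m := by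
    intro t h1 h2 m
    have p1 := zpow_pos hρ₁0 m
    have p2 := zpow_pos hρ₂0 m
    have ht : 0 < t := hρ₁0.trans h1
    rcases le_total 0 m with hm | hm
    · have := zpow_le_zpow_left₀ hm ht.le h2.le
      linarith
    · have : t ^ m ≤ ρ₁ ^ m := by
        obtain ⟨n, rfl⟩ : ∃ n : ℕ, m = -n := ⟨m.natAbs, by omega⟩
        rw [zpow_neg, zpow_neg, zpow_natCast, zpow_natCast]
        exact inv_anti₀ (by positivity) (pow_le_pow_left₀ hρ₁0.le h1.le n)
      linarith
  have hy' := norm_pos_iff.mpr hy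
  have hsum := ((summable_int_zpow_div hq hρ₁ (hρ₁'.trans hna2)).add
    (summable_int_zpow_div hq (hna1.trans hρ₂) hρ₂')).mul_left ((A + B) / (‖y‖ * c))
  have key := hasSum_deriv_of_dominated (F := fun m r => w ^ m * confluentCore q γ a x y m r)
    (a := 1) hsum ((hA.and hB).and (((hu1.and hu2).and (hv1.and hv2)).and hne))
    (fun m r hr => (differentiableAt_confluentCore hq hγ ha0 hx hy hr.2.2 m).const_mul _)
    (fun m hm r hr => ?_)
  · have hderiv : ∀ m, deriv (fun r => w ^ m * confluentCore q γ a x y m r) 1 =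
        w ^ m * deriv (confluentCore q γ a x y m) 1 := fun m =>
      deriv_const_mul _ (differentiableAt_confluentCore hq hγ ha0 hx hy one_ne_zero m)
    simp only [hderiv] at key
    convert! key using 1
    -- The cofactor of `r - 1` in the sum, from `θ(r²) = (1 - r)(1 + r) thetaReg(r²)`; the wanted
    -- derivative is `G(1)`.
    obtain ⟨G, hG⟩ : ∃ G : ℂ → ℂ, G = fun r => (1 + r) * (γ / r ^ 2) * qPoch q q ^ 2 *
        thetaReg q (r ^ 2) * theta q (x * (w * (γ / r ^ 2 * (a * r)))) *
        theta q (y * (γ / r ^ 2 * (a * r)) / w) /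
        (theta q (w * (a * r)) * theta q (w * (a / r))) := ⟨_, rfl⟩
    have hts : (fun r => ∑' m, w ^ m * confluentCore q γ a x y m r) =ᶠ[𝓝 1]
        fun r => (r - 1) * G r := by
      filter_upwards [hxne, hyne, hu1, hu2, hv1, hv2, hne] with r h1 h2 h3 h4 h5 h6 hr
      have hδ0 : γ / r ^ 2 ≠ 0 := div_ne_zero hγ (pow_ne_zero 2 hr)
      have hs := hasSum_core hq (w := w) (u := a * r) (v := a / r) hx hy hγ hδ0
        (by rw [← ha]; field_simp) (by field_simp)
        (by rw [norm_mul, hw, one_mul]; exact hρ₁.trans h3)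
        (by rw [norm_mul, hw, one_mul]; exact h4.trans hρ₂')
        (by rw [norm_mul, hw, one_mul]; exact hρ₁.trans h5)
        (by rw [norm_mul, hw, one_mul]; exact h6.trans hρ₂') h2 h1 hxy
      unfold confluentCore
      rw [hs.tsum_eq, coreSum, hG, div_div_cancel₀ hγ, theta_eq_mul_thetaReg hq (r ^ 2)]
      ring
    have hGd : DifferentiableAt ℂ G 1 := by
      rw [hG]
      have d0 : DifferentiableAt ℂ (fun r : ℂ => a * r) 1 := by fun_prop
      have d1 : DifferentiableAt ℂ (fun r : ℂ => a / r) 1 :=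
        (differentiableAt_const a).fun_div differentiableAt_id one_ne_zero
      have d2 : DifferentiableAt ℂ (fun r : ℂ => γ / r ^ 2 * (a * r)) 1 := hδ1.fun_mul d0
      have d3 : DifferentiableAt ℂ (fun r : ℂ => thetaReg q (r ^ 2)) 1 :=
        DifferentiableAt.fun_comp' 1 (differentiableAt_thetaReg hq (by simp)) (by fun_prop)
      have d4 := differentiableAt_theta_comp hq ((d2.const_mul w).const_mul x) (by
        rw [e1, mul_one]; positivity)
      have d5 := differentiableAt_theta_comp hq ((d2.const_mul y).div_const w) (by
        rw [e1, mul_one]; positivity)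
      have d6 := differentiableAt_theta_comp hq (d0.const_mul w) (by rw [mul_one]; positivity)
      have d7 := differentiableAt_theta_comp hq (d1.const_mul w) (by rw [div_one]; positivity)
      have hwa : theta q (w * a) ≠ 0 := theta_ne_zero_of_norm hq
        (by rw [norm_mul, hw, one_mul]; exact hna1) (by rw [norm_mul, hw, one_mul]; exact hna2)
      have d8 : DifferentiableAt ℂ (fun r : ℂ => 1 + r) 1 := by fun_prop
      exact (((((d8.fun_mul hδ1).mul_const _).fun_mul d3).fun_mul d4).fun_mul d5).fun_div
        (d6.fun_mul d7) (by rw [mul_one, div_one]; exact mul_ne_zero hwa hwa)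
    rw [hts.deriv_eq]
    have := (((hasDerivAt_id (1 : ℂ)).sub_const 1).fun_mul hGd.hasDerivAt).deriv
    simp only [id, sub_self, zero_mul, one_mul, add_zero] at this
    rw [this, hG]
    simp only [one_pow, div_one, mul_one, thetaReg_one]
    ring
  · obtain ⟨⟨hrA, hrB⟩, ⟨⟨h3, h4⟩, h5, h6⟩, hr0⟩ := hr
    have hp := zpow_pos hq.1 m
    have hd := hden m hm
    have hd' : 0 < ‖y‖ * (c * (1 + q ^ m)) := by positivity
    have p1 := zpow_pos hρ₁0 m
    have p2 := zpow_pos hρ₂0 m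
    simp only [confluentCore, core, hm, and_false, if_false]
    rw [norm_mul, norm_zpow, hw, one_zpow, one_mul, norm_div, coreNum]
    have hn : ‖theta q (x * (γ / r ^ 2)) * theta q (y * γ) * (a * r) ^ m -
        theta q (x * γ) * theta q (y * (γ / r ^ 2)) * (a / r) ^ m‖ ≤
        A * (ρ₁ ^ m + ρ₂ ^ m) + B * (ρ₁ ^ m + ρ₂ ^ m) := by
      refine (norm_sub_le _ _).trans ?_
      rw [norm_mul _ ((a * r) ^ m), norm_mul _ ((a / r) ^ m), norm_zpow, norm_zpow]
      have := hzpow _ h3 h4 m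
      have := hzpow _ h5 h6 m
      have := (norm_nonneg _).trans hrA.le
      have := (norm_nonneg _).trans hrB.le
      gcongr
    calc _ ≤ (A * (ρ₁ ^ m + ρ₂ ^ m) + B * (ρ₁ ^ m + ρ₂ ^ m)) / (‖y‖ * (c * (1 + q ^ m))) := by
          have := (norm_nonneg _).trans hn
          gcongr
      _ = _ := by field_simp

/-! ### Positivity of theta products at admissible pairs -/

lemma qPoch_conj {q : ℝ} (hq : 0 < q ∧ q < 1) (z : ℂ) :
    qPoch q ((starRingEnd ℂ) z) = (starRingEnd ℂ) (qPoch q z) := by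
  unfold qPoch
  rw [(multipliable_qPoch hq z).map_tprod (starRingEnd ℂ) Complex.continuous_conj]
  refine tprod_congr fun i => ?_
  simp

lemma theta_conj {q : ℝ} (hq : 0 < q ∧ q < 1) (z : ℂ) :
    theta q ((starRingEnd ℂ) z) = (starRingEnd ℂ) (theta q z) := by
  rw [theta, theta, map_mul, ← qPoch_conj hq, ← qPoch_conj hq]
  simp

lemma exists_qPoch_eq_pos {q : ℝ} (hq : 0 < q ∧ q < 1) {x : ℝ} (h : x < 1) :
    ∃ t : ℝ, 0 < t ∧ qPoch q x = t := by
  have hpos : ∀ i : ℕ, 0 < 1 + -(x * q ^ i) := by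
    intro i
    have h1 : q ^ i ≤ 1 := pow_le_one₀ hq.1.le hq.2.le
    have h2 : 0 < q ^ i := pow_pos hq.1 i
    nlinarith
  have hs : Summable fun i : ℕ => -(x * q ^ i) :=
    ((summable_geometric_of_lt_one hq.1.le hq.2).mul_left x).neg
  refine ⟨∏' i : ℕ, (1 + -(x * q ^ i)), ?_, ?_⟩
  · rw [← Real.rexp_tsum_eq_tprod hpos (Real.summable_log_one_add_of_summable hs)]
    exact Real.exp_pos _
  · have hm := (Real.multipliable_one_add_of_summable hs).map_tprod Complex.ofRealHom
      Complex.continuous_ofReal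
    simp only [Complex.ofRealHom_eq_coe] at hm
    rw [hm, qPoch]
    refine tprod_congr fun i => ?_
    push_cast
    ring

lemma exists_theta_eq_pos {q : ℝ} (hq : 0 < q ∧ q < 1) {x : ℝ} (h : x < 0 ∨ (q < x ∧ x < 1)) :
    ∃ t : ℝ, 0 < t ∧ theta q x = t := by
  obtain ⟨a, ha, ha'⟩ := exists_qPoch_eq_pos hq (x := x) (by
    rcases h with h | h <;> linarith)
  obtain ⟨b, hb, hb'⟩ := exists_qPoch_eq_pos hq (x := q / x) (by
    rcases h with h | h
    · exact (div_neg_of_pos_of_neg hq.1 h).trans one_pos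
    · exact (div_lt_one (hq.1.trans h.1)).mpr h.1)
  refine ⟨a * b, mul_pos ha hb, ?_⟩
  rw [theta, ha']
  push_cast at hb' ⊢
  rw [hb']

/-- The same `c` appears in both conclusions, so that it cancels between the numerator of `funP` and
its square root. -/
lemma exists_theta_zpow_mul_theta_zpow {q : ℝ} (hq : 0 < q ∧ q < 1) (k : ℤ) :
    ∃ c : ℝ, 0 < c ∧ ∀ z : ℂ, ∀ s : ℝ, 0 < s → ∀ t : ℝ, 0 < t → ∀ z' : ℂ, z * z' = s →
      theta q z * theta q z' = t →
      theta q ((q : ℂ) ^ k * z) = c * (-z) ^ (-k) * theta q z ∧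
      theta q ((q : ℂ) ^ k * z) * theta q ((q : ℂ) ^ k * z') =
        ((c ^ 2 * s ^ (-k) * t : ℝ) : ℂ) := by
  obtain ⟨c, hc, h⟩ := exists_theta_zpow_mul hq k
  refine ⟨c, hc, fun z s hs t ht z' hz hθ => ?_⟩
  have hzz : z * z' ≠ 0 := by rw [hz]; exact ofReal_ne_zero_of_pos hs
  have hz0 : z ≠ 0 := left_ne_zero_of_mul hzz
  have hz0' : z' ≠ 0 := right_ne_zero_of_mul hzz
  refine ⟨h z hz0, ?_⟩
  rw [h z hz0, h z' hz0']
  push_cast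
  rw [← hz, ← hθ, ← neg_mul_neg z z', mul_zpow]
  ring

lemma exists_theta_mul_theta_eq_pos {q : ℝ} (hq : 0 < q ∧ q < 1) {x y : ℝ}
    (h : (x < 0 ∧ y < 0) ∨ ∃ k : ℤ, (q ^ (k + 1) < x ∧ x < q ^ k) ∧ (q ^ (k + 1) < y ∧ y < q ^ k)) :
    ∃ t : ℝ, 0 < t ∧ theta q x * theta q y = t := by
  rcases h with ⟨hx, hy⟩ | ⟨k, hx, hy⟩
  · obtain ⟨a, ha, ha'⟩ := exists_theta_eq_pos hq (Or.inl hx)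
    obtain ⟨b, hb, hb'⟩ := exists_theta_eq_pos hq (Or.inl hy)
    exact ⟨a * b, mul_pos ha hb, by rw [ha', hb']; push_cast; rfl⟩
  · have hk := zpow_pos hq.1 k
    have hq' := ofReal_ne_zero_of_pos hq.1
    have aux : ∀ z : ℝ, q ^ (k + 1) < z ∧ z < q ^ k → q < z / q ^ k ∧ z / q ^ k < 1 := by
      intro z hz
      rw [zpow_add_one₀ hq.1.ne'] at hz
      exact ⟨(lt_div_iff₀ hk).mpr (by linarith), (div_lt_one hk).mpr hz.2⟩
    obtain ⟨a, ha, ha'⟩ := exists_theta_eq_pos hq (Or.inr (aux x hx))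
    obtain ⟨b, hb, hb'⟩ := exists_theta_eq_pos hq (Or.inr (aux y hy))
    obtain ⟨c, hc, h⟩ := exists_theta_zpow_mul_theta_zpow hq k
    have hpx := hq.1.trans (aux x hx).1
    have hpy := hq.1.trans (aux y hy).1
    have := (h ((x / q ^ k : ℝ) : ℂ) (x / q ^ k * (y / q ^ k)) (mul_pos hpx hpy) (a * b)
      (mul_pos ha hb) ((y / q ^ k : ℝ) : ℂ) (by push_cast; rfl)
      (by rw [ha', hb']; push_cast; rfl)).2
    refine ⟨c ^ 2 * (x / q ^ k * (y / q ^ k)) ^ (-k) * (a * b), ?_, ?_⟩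
    · have := zpow_pos (mul_pos hpx hpy) (-k)
      positivity
    · have e : ∀ z : ℝ, (q : ℂ) ^ k * ((z / q ^ k : ℝ) : ℂ) = z := fun z => by
        push_cast
        field_simp
      rw [← this, e, e]

/-- For conjugate pairs each theta product is `|θ(ζγ)|²`, nonzero because `ζγ` is not real. For real
pairs, one of `ζ₊`, `ζ₋` sends both parameters into the same gap of `q^ℤ` and the other makes both
negative. The norm inequalities later place `|u|` and `|v|` in `(q, 1)`. -/
lemma IsAdmissiblePair.facts {q ζp ζm : ℝ} (hq : 0 < q ∧ q < 1) (hζp : 0 < ζp) (hζm : ζm < 0)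
    {γ δ : ℂ} (h : IsAdmissiblePair q ζp ζm γ δ) :
    (∃ p : ℝ, 0 < p ∧ γ * δ = p) ∧ q * ‖δ‖ < ‖γ‖ ∧ q * ‖γ‖ < ‖δ‖ ∧
      ∀ s : Sgn, ∃ t : ℝ, 0 < t ∧
        theta q (zeta ζp ζm s * γ) * theta q (zeta ζp ζm s * δ) = t := by
  rcases h with ⟨hi, rfl⟩ | ⟨a, b, rfl, rfl, h⟩
  · have hγ : γ ≠ 0 := by rintro rfl; simp at hi
    have hn := norm_pos_iff.mpr hγ
    refine ⟨⟨‖γ‖ ^ 2, by positivity, ?_⟩, ?_, ?_, fun s => ?_⟩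
    · rw [Complex.mul_conj']; push_cast; rfl
    · rw [Complex.norm_conj]; nlinarith [hq.2]
    · rw [Complex.norm_conj]; nlinarith [hq.2]
    · have hz : zeta ζp ζm s ≠ 0 := by cases s; exacts [hζp.ne', hζm.ne]
      have e : (zeta ζp ζm s : ℂ) * (starRingEnd ℂ) γ = (starRingEnd ℂ) (zeta ζp ζm s * γ) := by
        simp
      have hne : theta q (zeta ζp ζm s * γ) ≠ 0 := by
        rw [Ne, theta_eq_zero_iff hq (mul_ne_zero (by exact_mod_cast hz) hγ)]
        rintro ⟨k, hk⟩
        have h1 := congrArg Complex.im hk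
        rw [Complex.im_ofReal_mul, ← Complex.ofReal_zpow, Complex.ofReal_im] at h1
        exact (mul_ne_zero hz hi) h1
      refine ⟨‖theta q (zeta ζp ζm s * γ)‖ ^ 2, by have := norm_pos_iff.mpr hne; positivity, ?_⟩
      rw [e, theta_conj hq, Complex.mul_conj']; push_cast; rfl
  · have key : ∀ ζ ξ : ℝ, 0 < ζ * ζ → ζ * ξ < 0 → (∃ m : ℤ,
        (q ^ (m + 1) < ζ * a ∧ ζ * a < q ^ m) ∧ (q ^ (m + 1) < ζ * b ∧ ζ * b < q ^ m)) →
        (0 < a * b ∧ q * |b| < |a| ∧ q * |a| < |b|) ∧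
        (∃ t : ℝ, 0 < t ∧ theta q (ζ * a) * theta q (ζ * b) = t) ∧
        (∃ t : ℝ, 0 < t ∧ theta q (ξ * a) * theta q (ξ * b) = t) := by
      rintro ζ ξ hζ hξ ⟨m, h1, h2⟩
      have hm := zpow_pos hq.1 m
      have hm1 := zpow_pos hq.1 (m + 1)
      have pa : 0 < ζ * a := hm1.trans h1.1
      have pb : 0 < ζ * b := hm1.trans h2.1
      have hζ' : 0 < |ζ| := abs_pos.mpr (by rintro rfl; simp at hζ)
      have ea : |ζ| * |a| = ζ * a := by rw [← abs_mul, abs_of_pos pa]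
      have eb : |ζ| * |b| = ζ * b := by rw [← abs_mul, abs_of_pos pb]
      have hq1 := zpow_add_one₀ hq.1.ne' m
      refine ⟨⟨?_, ?_, ?_⟩, ?_, ?_⟩
      · have : 0 < (ζ * ζ) * (a * b) := by nlinarith
        exact pos_of_mul_pos_right this hζ.le
      · refine lt_of_mul_lt_mul_left ?_ hζ'.le
        rw [ea, mul_left_comm, eb]
        have := mul_lt_mul_of_pos_left h2.2 hq.1
        linarith [h1.1]
      · refine lt_of_mul_lt_mul_left ?_ hζ'.le
        rw [eb, mul_left_comm, ea]
        have := mul_lt_mul_of_pos_left h1.2 hq.1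
        linarith [h2.1]
      · have := exists_theta_mul_theta_eq_pos hq (x := ζ * a) (y := ζ * b) (Or.inr ⟨m, h1, h2⟩)
        push_cast at this
        exact this
      · have n : ∀ c : ℝ, 0 < ζ * c → ξ * c < 0 := by
          intro c hc
          have h3 : (ζ * ζ) * (ξ * c) < 0 := by nlinarith
          exact neg_of_mul_neg_right h3 hζ.le
        have := exists_theta_mul_theta_eq_pos hq (x := ξ * a) (y := ξ * b)
          (Or.inl ⟨n a pa, n b pb⟩)
        push_cast at this
        exact this
    have fin : (0 < a * b ∧ q * |b| < |a| ∧ q * |a| < |b|) ∧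
        (∃ t : ℝ, 0 < t ∧ theta q (ζp * a) * theta q (ζp * b) = t) ∧
        (∃ t : ℝ, 0 < t ∧ theta q (ζm * a) * theta q (ζm * b) = t) := by
      rcases h with ⟨m, ⟨h1, h2⟩, h3, h4⟩ | ⟨m, ⟨h1, h2⟩, h3, h4⟩
      · have c1 : ∀ x y : ℝ, ζm⁻¹ * x < y → ζm * y < x := fun x y hxy => by
          rwa [inv_mul_eq_div, div_lt_iff_of_neg' hζm] at hxy
        have c2 : ∀ x y : ℝ, y < ζm⁻¹ * x → x < ζm * y := fun x y hxy => by
          rwa [inv_mul_eq_div, lt_div_iff_of_neg' hζm] at hxy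
        obtain ⟨k1, k2, k3⟩ := key ζm ζp (by nlinarith) (by nlinarith)
          ⟨m, ⟨c2 _ _ h2, c1 _ _ h1⟩, c2 _ _ h4, c1 _ _ h3⟩
        exact ⟨k1, k3, k2⟩
      · have c1 : ∀ x y : ℝ, ζp⁻¹ * x < y → x < ζp * y := fun x y hxy => by
          rwa [inv_mul_eq_div, div_lt_iff₀' hζp] at hxy
        have c2 : ∀ x y : ℝ, y < ζp⁻¹ * x → ζp * y < x := fun x y hxy => by
          rwa [inv_mul_eq_div, lt_div_iff₀' hζp] at hxy
        exact key ζp ζm (by nlinarith) (by nlinarith)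
          ⟨m, ⟨c1 _ _ h1, c2 _ _ h2⟩, c1 _ _ h3, c2 _ _ h4⟩
    refine ⟨⟨a * b, fin.1.1, by push_cast; rfl⟩, ?_, ?_, fun s => ?_⟩
    · simpa using fin.1.2.1
    · simpa using fin.1.2.2
    · cases s
      · exact fin.2.1
      · exact fin.2.2

/-! ### The kernel at lattice points -/

lemma posSqrt_ofReal (t : ℝ) : posSqrt t = (Real.sqrt t : ℂ) := by simp [posSqrt]

lemma posSqrt_sq {z : ℂ} {t : ℝ} (ht : 0 < t) (h : z = t) : posSqrt z ^ 2 = z := by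
  rw [h, posSqrt_ofReal, ← Complex.ofReal_pow, Real.sq_sqrt ht.le]

lemma posSqrt_ne_zero {z : ℂ} {t : ℝ} (ht : 0 < t) (h : z = t) : posSqrt z ≠ 0 := by
  rw [h, posSqrt_ofReal]
  exact ofReal_ne_zero_of_pos (Real.sqrt_pos.mpr ht)

lemma funQ_eq_funP (q : ℝ) (γ δ : ℂ) (x : ℝ) : funQ q γ δ x = funP q δ γ x := by
  simp only [funQ, funP, thetas, List.map_cons, List.map_nil, List.prod_cons, List.prod_nil,
    mul_one]
  rw [mul_comm (theta q (x * γ)) (theta q (x * δ))]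

/-- The quadratic exponent in the quasi-periodicity of `theta` cancels against the square root. What
remains is geometric in `m`, which brings the kernel within reach of the Kronecker formula. -/
lemma funP_mul_zpow {q : ℝ} (hq : 0 < q ∧ q < 1) {γ δ : ℂ} {p : ℝ} (hp : 0 < p) (hγδ : γ * δ = p)
    {ζ : ℝ} (hζ : ζ ≠ 0) {t : ℝ} (ht : 0 < t) (hθ : theta q (ζ * γ) * theta q (ζ * δ) = t) (m : ℤ) :
    funP q γ δ (ζ * q ^ m) = (|ζ| / (-ζ) : ℂ) ^ m * ((Real.sqrt q * Real.sqrt p : ℝ) / δ) ^ m *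
      funP q γ δ ζ := by
  have hq' := ofReal_ne_zero_of_pos hq.1
  have hγδ0 : γ * δ ≠ 0 := by rw [hγδ]; exact ofReal_ne_zero_of_pos hp
  have hδ : δ ≠ 0 := right_ne_zero_of_mul hγδ0
  have hζ' : (ζ : ℂ) ≠ 0 := by exact_mod_cast hζ
  have hqm := zpow_pos hq.1 m
  obtain ⟨c, hc, h⟩ := exists_theta_zpow_mul_theta_zpow hq m
  have hs : 0 < ζ ^ 2 * p := by positivity
  have h1 := (h (ζ * δ) (ζ ^ 2 * p) hs t ht (ζ * γ)
    (by push_cast; rw [← hγδ]; ring) (by rw [← hθ]; ring))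
  have e : ∀ z : ℂ, ((ζ * q ^ m : ℝ) : ℂ) * z = (q : ℂ) ^ m * (ζ * z) := fun z => by
    push_cast; ring
  simp only [funP, thetas, List.map_cons, List.map_nil, List.prod_cons, List.prod_nil, mul_one]
  rw [e, e, hθ, mul_comm (theta q ((q : ℂ) ^ m * (ζ * γ))), h1.2, h1.1, posSqrt_ofReal,
    posSqrt_ofReal]
  have e2 : Real.sqrt (c ^ 2 * (ζ ^ 2 * p) ^ (-m) * t) =
      c * (|ζ| * Real.sqrt p) ^ (-m) * Real.sqrt t := by
    have hz : 0 < (|ζ| * Real.sqrt p) ^ (-m) := zpow_pos (by positivity) _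
    have : c ^ 2 * (ζ ^ 2 * p) ^ (-m) * t = (c * (|ζ| * Real.sqrt p) ^ (-m)) ^ 2 * t := by
      rw [mul_pow, ← zpow_natCast (_ ^ (-m)), ← zpow_mul, mul_comm (-m), zpow_mul, zpow_natCast,
        mul_pow, sq_abs, Real.sq_sqrt hp.le]
    rw [this, Real.sqrt_mul (by positivity), Real.sqrt_sq (by positivity)]
  have e3 : Real.sqrt |ζ * q ^ m| = Real.sqrt |ζ| * Real.sqrt q ^ m := by
    have hz : 0 < Real.sqrt q ^ m := zpow_pos (Real.sqrt_pos.mpr hq.1) _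
    have : |ζ * q ^ m| = |ζ| * (Real.sqrt q ^ m) ^ 2 := by
      rw [abs_mul, abs_of_pos hqm, ← zpow_natCast (_ ^ m), ← zpow_mul, mul_comm m, zpow_mul,
        zpow_natCast, Real.sq_sqrt hq.1.le]
    rw [this, Real.sqrt_mul (abs_nonneg _), Real.sqrt_sq hz.le]
  rw [e2, e3]
  have hc' := ofReal_ne_zero_of_pos hc
  have hst := ofReal_ne_zero_of_pos (Real.sqrt_pos.mpr ht)
  have hsp := ofReal_ne_zero_of_pos (Real.sqrt_pos.mpr hp)
  have haz := ofReal_ne_zero_of_pos (abs_pos.mpr hζ)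
  have hsq := ofReal_ne_zero_of_pos (Real.sqrt_pos.mpr hq.1)
  push_cast
  have e4 : (|ζ| / -ζ : ℂ) ^ m * (Real.sqrt q * Real.sqrt p / δ : ℂ) ^ m =
      (Real.sqrt q : ℂ) ^ m * (-(ζ * δ) : ℂ) ^ (-m) * ((|ζ| * Real.sqrt p : ℂ) ^ (-m))⁻¹ := by
    rw [zpow_neg, zpow_neg, inv_inv, ← mul_zpow, ← inv_zpow, ← mul_zpow, ← mul_zpow]
    congr 1
    field_simp
  rw [e4]
  have hB : (|ζ| * Real.sqrt p : ℂ) ^ (-m) ≠ 0 := zpow_ne_zero _ (mul_ne_zero haz hsp)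
  field_simp

/-- The purpose of the gauge: the quotient `|ζ|/(-ζ)` is `-1` on the positive half and `1` on the
negative half, and the gauge makes the signs agree. -/
lemma gauge_mul_zpow {ζp ζm : ℝ} (hζp : 0 < ζp) (hζm : ζm < 0) (s : Sgn) (m : ℤ) :
    gauge s m * ((|zeta ζp ζm s| : ℝ) / (-(zeta ζp ζm s : ℂ))) ^ m = (-1) ^ m := by
  cases s
  · have h : (ζp : ℂ) ≠ 0 := ofReal_ne_zero_of_pos hζp
    simp only [gauge, zeta, abs_of_pos hζp, one_mul]
    congr 1
    field_simp
  · have h : (ζm : ℂ) ≠ 0 := by exact_mod_cast hζm.ne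
    simp only [gauge, zeta, abs_of_neg hζm, Complex.ofReal_neg]
    rw [div_self (neg_ne_zero.mpr h), one_zpow, mul_one]

/-- `funP` and `funQ` share the factor `√|x| / √(θ(xγ)θ(xδ))`. Its derivative drops out of the
Wronskian, so only its differentiability is needed. -/
lemma wronskian_funP {q : ℝ} (hq : 0 < q ∧ q < 1) {γ δ : ℂ} (hγ : γ ≠ 0) (hδ : δ ≠ 0)
    {ζ : ℝ} (hζ : ζ ≠ 0) {t : ℝ} (ht : 0 < t) (hθ : theta q (ζ * γ) * theta q (ζ * δ) = t) :
    deriv (funP q γ δ) ζ * funQ q γ δ ζ - deriv (funQ q γ δ) ζ * funP q γ δ ζ =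
      (Real.sqrt |ζ| / posSqrt (theta q (ζ * γ) * theta q (ζ * δ))) ^ 2 *
      (δ * deriv (theta q) (ζ * δ) * theta q (ζ * γ) -
        γ * deriv (theta q) (ζ * γ) * theta q (ζ * δ)) := by
  have hζ' : (ζ : ℂ) ≠ 0 := by exact_mod_cast hζ
  obtain ⟨g, hg⟩ : ∃ g : ℝ → ℂ, g = fun x : ℝ =>
    (Real.sqrt |x| / posSqrt (theta q (x * γ) * theta q (x * δ)) : ℂ) := ⟨_, rfl⟩
  have d1 : ∀ a : ℂ, a ≠ 0 → HasDerivAt (fun x : ℝ => theta q (x * a))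
      (a * deriv (theta q) (ζ * a)) ζ := by
    intro a ha
    have h1 := (differentiableAt_theta hq (mul_ne_zero hζ' ha)).hasDerivAt
    have h2 : HasDerivAt (fun x : ℂ => x * a) a ζ := by
      simpa using (hasDerivAt_id (ζ : ℂ)).mul_const a
    have h3 := (HasDerivAt.comp (ζ : ℂ) h1 h2).comp_ofReal
    rwa [mul_comm] at h3
  have hgd : DifferentiableAt ℝ g ζ := by
    have k1 : DifferentiableAt ℝ (fun x : ℝ => Real.sqrt |x|) ζ :=
      (differentiableAt_abs hζ).sqrt (abs_ne_zero.mpr hζ)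
    have k2 : DifferentiableAt ℝ
        (fun x : ℝ => (theta q (x * γ) * theta q (x * δ)).re) ζ :=
      Complex.reCLM.differentiableAt.fun_comp' ζ
        ((d1 γ hγ).differentiableAt.fun_mul (d1 δ hδ).differentiableAt)
    have k3 := k2.sqrt (by rw [hθ, Complex.ofReal_re]; exact ht.ne')
    have o : ∀ f : ℝ → ℝ, DifferentiableAt ℝ f ζ → DifferentiableAt ℝ (fun x => (f x : ℂ)) ζ :=
      fun f hf => Complex.ofRealCLM.differentiableAt.fun_comp' ζ hf
    rw [hg]
    exact (o _ k1).fun_div (o _ k3) (posSqrt_ne_zero ht hθ)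
  have hP : funP q γ δ = fun x : ℝ => g x * theta q (x * δ) := by
    funext x
    simp only [funP, hg, thetas, List.map_cons, List.map_nil, List.prod_cons, List.prod_nil,
      mul_one]
    ring
  have hQ : funQ q γ δ = fun x : ℝ => g x * theta q (x * γ) := by
    funext x
    simp only [funQ, hg, thetas, List.map_cons, List.map_nil, List.prod_cons, List.prod_nil,
      mul_one]
    ring
  rw [hP, hQ, (hgd.hasDerivAt.fun_mul (d1 δ hδ)).deriv, (hgd.hasDerivAt.fun_mul (d1 γ hγ)).deriv]
  have : (Real.sqrt |ζ| / posSqrt (theta q (ζ * γ) * theta q (ζ * δ)) : ℂ) = g ζ := by rw [hg]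
  rw [this]
  ring

/-- The factor relating the gauged kernel to `core`, for `γ ≠ δ`. -/
def coreFactor (q ζp ζm : ℝ) (γ δ : ℂ) (s t : Sgn) : ℂ :=
  constC q ζp ζm γ δ *
    ((Real.sqrt |zeta ζp ζm s| : ℂ) /
      posSqrt (theta q (zeta ζp ζm s * γ) * theta q (zeta ζp ζm s * δ))) *
    ((Real.sqrt |zeta ζp ζm t| : ℂ) /
      posSqrt (theta q (zeta ζp ζm t * γ) * theta q (zeta ζp ζm t * δ)))

lemma zeta_mul_zpow_eq_iff {q ζp ζm : ℝ} (hq : 0 < q ∧ q < 1) (hζp : 0 < ζp) (hζm : ζm < 0)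
    (s t : Sgn) (m : ℤ) :
    zeta ζp ζm s * q ^ m = zeta ζp ζm t ↔ (zeta ζp ζm s : ℂ) = zeta ζp ζm t ∧ m = 0 := by
  have hm := zpow_pos hq.1 m
  rw [Complex.ofReal_inj]
  constructor
  · intro h
    have hst : zeta ζp ζm s = zeta ζp ζm t := by
      cases s <;> cases t <;> simp only [zeta] at h ⊢
      · nlinarith
      · nlinarith
    refine ⟨hst, ?_⟩
    have hz : zeta ζp ζm t ≠ 0 := by cases t; exacts [hζp.ne', hζm.ne]
    rw [hst] at h
    have : q ^ m = 1 := mul_left_cancel₀ hz (by rw [h, mul_one])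
    exact (zpow_eq_one_iff_right₀ hq.1.le hq.2.ne).mp this
  · rintro ⟨h, rfl⟩
    rw [h, zpow_zero, mul_one]

lemma gauged_kernelOfNe {q ζp ζm : ℝ} (hq : 0 < q ∧ q < 1) (hζp : 0 < ζp) (hζm : ζm < 0)
    {γ δ : ℂ} (h : IsAdmissiblePair q ζp ζm γ δ) (s t : Sgn) (m : ℤ) :
    gauge s m * (gauge t 0)⁻¹ * kernelOfNe q ζp ζm γ δ (latticePoint q ζp ζm s m)
      (latticePoint q ζp ζm t 0) = coreFactor q ζp ζm γ δ s t *
      core q γ δ (-posSqrt (q * γ * δ) / δ) (-posSqrt (q * γ * δ) / γ)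
        (zeta ζp ζm s) (zeta ζp ζm t) m := by
  obtain ⟨⟨p, hp, hγδ⟩, -, -, hpos⟩ := h.facts hq hζp hζm
  have hγδ0 : γ * δ ≠ 0 := by rw [hγδ]; exact ofReal_ne_zero_of_pos hp
  have hδ : δ ≠ 0 := right_ne_zero_of_mul hγδ0
  have hγ : γ ≠ 0 := left_ne_zero_of_mul hγδ0
  have hz : ∀ s : Sgn, zeta ζp ζm s ≠ 0 := by
    rintro (_ | _)
    exacts [hζp.ne', hζm.ne]
  have hg0 : gauge t 0 = 1 := by cases t <;> simp [gauge]
  have hl0 : latticePoint q ζp ζm t 0 = zeta ζp ζm t := by simp [latticePoint]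
  have hτ : posSqrt (q * γ * δ) = (Real.sqrt q * Real.sqrt p : ℝ) := by
    rw [mul_assoc, hγδ, ← Complex.ofReal_mul, posSqrt_ofReal, Real.sqrt_mul hq.1.le]
  rw [hg0, inv_one, mul_one, hl0, kernelOfNe, core]
  simp only [latticePoint, zeta_mul_zpow_eq_iff hq hζp hζm]
  obtain ⟨c, hc, hcθ⟩ := hpos s
  by_cases hst : (zeta ζp ζm s : ℂ) = zeta ζp ζm t ∧ m = 0
  · rw [if_pos hst, if_pos hst]
    obtain ⟨hst', rfl⟩ := hst
    have hst'' : zeta ζp ζm s = zeta ζp ζm t := by exact_mod_cast hst'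
    have hgs : gauge s 0 = 1 := by cases s <;> simp [gauge]
    rw [hgs, one_mul, zpow_zero, mul_one, coreFactor, wronskian_funP hq hγ hδ (hz s) hc hcθ, ← hst'']
    ring
  · rw [if_neg hst, if_neg hst, coreNum, hτ]
    have hp1 := funP_mul_zpow hq hp hγδ (hz s) hc hcθ m
    have hp2 := funP_mul_zpow hq hp (by rw [← hγδ]; ring) (hz s) hc
      (γ := δ) (δ := γ) (by rw [← hcθ]; ring) m
    have hgauge := gauge_mul_zpow hζp hζm s m
    have hneg : ∀ a : ℂ, (-((Real.sqrt q * Real.sqrt p : ℝ) : ℂ) / a) ^ m =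
        (-1) ^ m * (((Real.sqrt q * Real.sqrt p : ℝ) : ℂ) / a) ^ m := fun a => by
      rw [← mul_zpow]; congr 1; ring
    rw [hneg, hneg, ← hgauge, funQ_eq_funP, funQ_eq_funP, hp1, hp2, ← funQ_eq_funP, coreFactor]
    simp only [funP, funQ, thetas, List.map_cons, List.map_nil, List.prod_cons, List.prod_nil,
      mul_one]
    rw [mul_comm (theta q (zeta ζp ζm t * δ)) (theta q (zeta ζp ζm t * γ))]
    push_cast
    ring_nf

/-! ### The Fourier transform of the kernel -/

lemma zeta_ne_zero {ζp ζm : ℝ} (hζp : 0 < ζp) (hζm : ζm < 0) (s : Sgn) :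
    (zeta ζp ζm s : ℂ) ≠ 0 := by
  cases s
  · exact ofReal_ne_zero_of_pos hζp
  · exact_mod_cast hζm.ne

/-- The part of `coreFactor` which remains finite for `γ = δ`. -/
def symbolFactor (q ζp ζm : ℝ) (γ δ : ℂ) (s t : Sgn) : ℂ :=
  thetas q [γ * ζm, γ * ζp, δ * ζm, δ * ζp] /
      (ζp * thetas q [(ζm : ℂ) / ζp, γ * δ * ζm * ζp]) *
    ((Real.sqrt |zeta ζp ζm s| : ℂ) /
      posSqrt (theta q (zeta ζp ζm s * γ) * theta q (zeta ζp ζm s * δ))) *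
    ((Real.sqrt |zeta ζp ζm t| : ℂ) /
      posSqrt (theta q (zeta ζp ζm t * γ) * theta q (zeta ζp ζm t * δ)))

/-- Isolates the part singular at `γ = δ`: the factor `1/θ(γ/δ)`, which meets the factor `θ(γ/δ)` of
`coreSum`. -/
lemma coreFactor_eq {q ζp ζm : ℝ} (hq : 0 < q ∧ q < 1) {γ δ : ℂ} (hγ : γ ≠ 0) (hδ : δ ≠ 0)
    (hne : γ ≠ δ) (s t : Sgn) : coreFactor q ζp ζm γ δ s t =
      -(symbolFactor q ζp ζm γ δ s t / (δ * theta q (γ / δ) * qPoch q q ^ 2)) := by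
  have h1 : qPoch q (δ / γ) * qPoch q (γ / δ) = (1 - δ / γ) * theta q (γ / δ) := by
    rw [qPoch_eq_mul hq (δ / γ), theta]
    have : (q : ℂ) / (γ / δ) = q * (δ / γ) := by field_simp
    rw [this]
    ring
  have h2 : (δ - γ) / (γ * δ * qPochs q [δ / γ, γ / δ, (q : ℂ), (q : ℂ)]) =
      -(1 / (δ * theta q (γ / δ) * qPoch q q ^ 2)) := by
    have h3 : δ - γ ≠ 0 := sub_ne_zero.mpr hne.symm
    have e : γ * δ * qPochs q [δ / γ, γ / δ, (q : ℂ), (q : ℂ)] =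
        (δ - γ) * (-(δ * theta q (γ / δ) * qPoch q q ^ 2)) := by
      simp only [qPochs, List.map_cons, List.map_nil, List.prod_cons, List.prod_nil, mul_one]
      calc _ = γ * δ * (qPoch q (δ / γ) * qPoch q (γ / δ)) * qPoch q q ^ 2 := by ring
        _ = _ := by
          rw [h1]
          generalize theta q (γ / δ) = T
          field_simp
          ring
    rw [e, ← div_div, div_self h3, div_neg]
  rw [coreFactor, constC, h2, symbolFactor]
  ring

lemma theta_zeta_mul_inv_ne_zero {q ζp ζm : ℝ} (hq : 0 < q ∧ q < 1) (hζp : 0 < ζp) (hζm : ζm < 0)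
    (s t : Sgn) : (zeta ζp ζm s : ℂ) = zeta ζp ζm t ∨
      theta q (zeta ζp ζm s * (zeta ζp ζm t : ℂ)⁻¹) ≠ 0 := by
  have key : ∀ x y : ℝ, x * y < 0 → theta q (x * (y : ℂ)⁻¹) ≠ 0 := by
    intro x y h
    have hy : y ≠ 0 := by rintro rfl; simp at h
    obtain ⟨a, ha, ha'⟩ := exists_theta_eq_pos hq (x := x * y⁻¹) (Or.inl (by
      have : x * y⁻¹ = x * y * (y⁻¹) ^ 2 := by field_simp
      rw [this]
      exact mul_neg_of_neg_of_pos h (by positivity)))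
    push_cast at ha'
    rw [ha']
    exact ofReal_ne_zero_of_pos ha
  cases s <;> cases t
  · exact Or.inl rfl
  · exact Or.inr (key _ _ (mul_neg_of_pos_of_neg hζp hζm))
  · exact Or.inr (key _ _ (mul_neg_of_neg_of_pos hζm hζp))
  · exact Or.inl rfl

/-- Matches `u` for the pair `(γ, d)` with `a r`, where `r = √(γ/d)`. The form is valid for both
signs of the real parameters. -/
lemma sqrt_mul_div_eq {q a b : ℝ} (hab : 0 < a * b) :
    Real.sqrt (q * a * b) / b = Real.sqrt (q * a * a) / a * Real.sqrt (a / b) := by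
  have ha : a ≠ 0 := left_ne_zero_of_mul hab.ne'
  have hb : b ≠ 0 := right_ne_zero_of_mul hab.ne'
  have hba : 0 < b / a := by
    have : b / a = a * b * (a⁻¹) ^ 2 := by field_simp
    rw [this]; positivity
  have h1 : q * a * b = (q * a * a) * (a / b) * (b / a) ^ 2 := by field_simp
  have hab' : 0 < a / b := by rw [← inv_div]; exact inv_pos.mpr hba
  rw [h1, Real.sqrt_mul' _ (by positivity), Real.sqrt_mul' _ hab'.le, Real.sqrt_sq hba.le]
  field_simp

lemma continuousAt_posSqrt {f : ℂ → ℂ} {z : ℂ} (hf : ContinuousAt f z) :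
    ContinuousAt (fun x => posSqrt (f x)) z := by
  have h : Continuous posSqrt := by
    unfold posSqrt
    fun_prop
  exact h.continuousAt.comp' hf

lemma theta_denominators_ne_zero {q ζp ζm : ℝ} (hq : 0 < q ∧ q < 1) (hζp : 0 < ζp) (hζm : ζm < 0)
    {γ δ : ℂ} {p : ℝ} (hp : 0 < p) (h : γ * δ = p) :
    theta q ((ζm : ℂ) / ζp) ≠ 0 ∧ γ * δ * ζm * ζp ≠ 0 ∧ theta q (γ * δ * ζm * ζp) ≠ 0 := by
  obtain ⟨a, ha, ha'⟩ := exists_theta_eq_pos hq (x := ζm / ζp) (Or.inl (div_neg_of_neg_of_pos hζm hζp))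
  have hneg : p * ζm * ζp < 0 := mul_neg_of_neg_of_pos (mul_neg_of_pos_of_neg hp hζm) hζp
  obtain ⟨b, hb, hb'⟩ := exists_theta_eq_pos hq (x := p * ζm * ζp) (Or.inl hneg)
  push_cast at ha' hb'
  refine ⟨?_, ?_, ?_⟩
  · rw [ha']; exact ofReal_ne_zero_of_pos ha
  · rw [h]; exact_mod_cast hneg.ne
  · rw [h, hb']; exact ofReal_ne_zero_of_pos hb

lemma continuousAt_symbolFactor {q ζp ζm : ℝ} (hq : 0 < q ∧ q < 1) (hζp : 0 < ζp) (hζm : ζm < 0)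
    {γ : ℂ} (h : IsAdmissiblePair q ζp ζm γ γ) (s t : Sgn) :
    ContinuousAt (fun d => symbolFactor q ζp ζm γ d s t) γ := by
  obtain ⟨⟨p, hp, hγδ⟩, -, -, hpos⟩ := h.facts hq hζp hζm
  have hγ : γ ≠ 0 := left_ne_zero_of_mul (hγδ ▸ ofReal_ne_zero_of_pos hp)
  have hθ : ∀ f : ℂ → ℂ, ContinuousAt f γ → f γ ≠ 0 → ContinuousAt (fun d => theta q (f d)) γ :=
    fun f hf h0 => (differentiableAt_theta hq h0).continuousAt.comp' hf
  have hp' := ofReal_ne_zero_of_pos hζp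
  have hm' : (ζm : ℂ) ≠ 0 := by exact_mod_cast hζm.ne
  obtain ⟨t1, t2, t3⟩ := theta_denominators_ne_zero hq hζp hζm hp hγδ
  have hN : ∀ s : Sgn, ContinuousAt (fun d => (Real.sqrt |zeta ζp ζm s| : ℂ) /
      posSqrt (theta q (zeta ζp ζm s * γ) * theta q (zeta ζp ζm s * d))) γ := by
    intro s
    obtain ⟨c, hc, hcθ⟩ := hpos s
    refine continuousAt_const.div (continuousAt_posSqrt (continuousAt_const.mul (hθ _ ?_ ?_)))
      (posSqrt_ne_zero hc hcθ)
    · fun_prop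
    · exact mul_ne_zero (zeta_ne_zero hζp hζm s) hγ
  unfold symbolFactor
  refine ContinuousAt.mul (ContinuousAt.mul ?_ (hN s)) (hN t)
  simp only [thetas, List.map_cons, List.map_nil, List.prod_cons, List.prod_nil, mul_one]
  have c1 := hθ (fun d => d * ζm) (by fun_prop) (mul_ne_zero hγ hm')
  have c2 := hθ (fun d => d * ζp) (by fun_prop) (mul_ne_zero hγ hp')
  have c3 := hθ (fun d => γ * d * ζm * ζp) (by fun_prop) t2
  exact (continuousAt_const.mul (continuousAt_const.mul (c1.mul c2))).div
    (continuousAt_const.mul (continuousAt_const.mul c3))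
    (mul_ne_zero hp' (mul_ne_zero t1 t3))

lemma IsAdmissiblePair.exists_real {q ζp ζm : ℝ} {γ d : ℂ} (h : IsAdmissiblePair q ζp ζm γ γ)
    (hd : IsAdmissiblePair q ζp ζm γ d) : ∃ a b : ℝ, γ = a ∧ d = b := by
  have hi : γ.im = 0 := by
    rcases h with ⟨-, h⟩ | ⟨a, -, rfl, -⟩
    · exact Complex.conj_eq_iff_im.mp h.symm
    · simp
  rcases hd with ⟨h, -⟩ | ⟨a, b, h1, h2, -⟩
  · exact absurd hi h
  · exact ⟨a, b, h1, h2⟩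

/-- A pair `(γ, γ)` is admissible only in a complementary series, where nearby real `d` stay in the
same open interval. Hence the limit defining the confluent kernel runs over a nontrivial filter. -/
lemma neBot_admissible {q ζp ζm : ℝ} {γ : ℂ} (h : IsAdmissiblePair q ζp ζm γ γ) :
    (𝓝[{d : ℂ | IsAdmissiblePair q ζp ζm γ d ∧ d ≠ γ}] γ).NeBot := by
  obtain ⟨a, -, rfl, -⟩ := h.exists_real h
  have hev : ∀ᶠ b : ℝ in 𝓝 a, IsAdmissiblePair q ζp ζm a b := by
    rcases h with ⟨h, -⟩ | ⟨a', b', h1, -, h⟩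
    · simp at h
    · have e : a = a' := by exact_mod_cast h1
      subst e
      rcases h with ⟨m, h, -⟩ | ⟨m, h, -⟩
      · filter_upwards [eventually_gt_nhds h.1, eventually_lt_nhds h.2] with b h1 h2
        exact Or.inr ⟨a, b, rfl, rfl, Or.inl ⟨m, h, h1, h2⟩⟩
      · filter_upwards [eventually_gt_nhds h.1, eventually_lt_nhds h.2] with b h1 h2
        exact Or.inr ⟨a, b, rfl, rfl, Or.inr ⟨m, h, h1, h2⟩⟩
  have ht : Tendsto (fun b : ℝ => (b : ℂ)) (𝓝[≠] a)
      (𝓝[{d : ℂ | IsAdmissiblePair q ζp ζm a d ∧ d ≠ a}] (a : ℂ)) := by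
    refine tendsto_nhdsWithin_iff.mpr
      ⟨(Complex.continuous_ofReal.tendsto a).mono_left nhdsWithin_le_nhds, ?_⟩
    filter_upwards [nhdsWithin_le_nhds hev, self_mem_nhdsWithin] with b hb hne
    exact ⟨hb, by exact_mod_cast hne⟩
  exact ht.neBot

lemma confluentCore_one (q : ℝ) (γ a x y : ℂ) (m : ℤ) : confluentCore q γ a x y m 1 = 0 := by
  simp only [confluentCore, core, coreNum, one_pow, div_one, mul_one]
  split_ifs with h
  · ring
  · rw [show theta q (x * γ) * theta q (y * γ) * a ^ m - theta q (x * γ) * theta q (y * γ) * a ^ m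
      = 0 by ring, zero_div]

lemma gauge_ne_zero (s : Sgn) (m : ℤ) : gauge s m ≠ 0 := by
  cases s
  · exact one_ne_zero
  · exact zpow_ne_zero _ (by norm_num)

/-- With `r = √(γ/d)`, the kernel for `(γ, d)` is a continuous factor times `confluentCore(r) / (r -
1)`. Since `confluentCore` vanishes at `r = 1`, this is a difference quotient and tends to the
derivative there. -/
lemma gaugedKernel_confluent {q ζp ζm : ℝ} (hq : 0 < q ∧ q < 1) (hζp : 0 < ζp) (hζm : ζm < 0)
    {γ : ℂ} (h : IsAdmissiblePair q ζp ζm γ γ) (s t : Sgn) (m : ℤ) :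
    gaugedKernel q ζp ζm γ γ s m t 0 =
      symbolFactor q ζp ζm γ γ s t / (2 * γ * qPoch q q ^ 4) *
        deriv (confluentCore q γ (-posSqrt (q * γ * γ) / γ) (zeta ζp ζm s) (zeta ζp ζm t) m) 1 := by
  obtain ⟨⟨p, hp, hγγ⟩, -, -, -⟩ := h.facts hq hζp hζm
  have hγ : γ ≠ 0 := left_ne_zero_of_mul (hγγ ▸ ofReal_ne_zero_of_pos hp)
  have hqq := qPoch_self_ne_zero hq
  obtain ⟨S, hS⟩ : ∃ S : Set ℂ, S = {d : ℂ | IsAdmissiblePair q ζp ζm γ d ∧ d ≠ γ} := ⟨_, rfl⟩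
  obtain ⟨a, ha⟩ : ∃ a : ℂ, a = -posSqrt (q * γ * γ) / γ := ⟨_, rfl⟩
  have ha0 : a ≠ 0 := by
    rw [ha]
    refine div_ne_zero (neg_ne_zero.mpr (posSqrt_ne_zero (t := q * p) (mul_pos hq.1 hp) ?_)) hγ
    rw [mul_assoc, hγγ]; push_cast; rfl
  obtain ⟨r, hr⟩ : ∃ r : ℂ → ℂ, r = fun d => posSqrt (γ / d) := ⟨_, rfl⟩
  have hdiv : ContinuousAt (fun d : ℂ => γ / d) γ := continuousAt_const.div continuousAt_id hγ
  have hrc : ContinuousAt r γ := by rw [hr]; exact continuousAt_posSqrt hdiv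
  have hr1 : r γ = 1 := by
    rw [hr]
    simp only [div_self hγ]
    simp [posSqrt]
  have hrS : ∀ d ∈ S, d ≠ 0 ∧ r d ^ 2 = γ / d ∧ r d ≠ 0 ∧ r d ≠ 1 ∧
      -posSqrt (q * γ * d) / d = a * r d := by
    intro d hd
    rw [hS] at hd
    obtain ⟨⟨p', hp', hγd⟩, -, -, -⟩ := hd.1.facts hq hζp hζm
    obtain ⟨x, y, hx, hy⟩ := h.exists_real hd.1
    have hxy : 0 < x * y := by
      rw [hx, hy] at hγd
      have : x * y = p' := by exact_mod_cast hγd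
      rw [this]; exact hp'
    have hd0 : d ≠ 0 := right_ne_zero_of_mul (hγd ▸ ofReal_ne_zero_of_pos hp')
    have hy0 : y ≠ 0 := right_ne_zero_of_mul hxy.ne'
    have hxy' : 0 < x / y := by
      have : x / y = x * y * (y⁻¹) ^ 2 := by field_simp
      rw [this]; positivity
    have e : γ / d = (x / y : ℝ) := by rw [hx, hy]; push_cast; rfl
    have h2 : r d ^ 2 = γ / d := by rw [hr]; exact posSqrt_sq hxy' e
    refine ⟨hd0, h2, ?_, ?_, ?_⟩
    · rw [hr]; exact posSqrt_ne_zero hxy' e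
    · intro h1
      rw [h1, one_pow, eq_div_iff hd0, one_mul] at h2
      exact hd.2 h2
    · have k := sqrt_mul_div_eq (q := q) hxy
      have k' := congrArg (fun z : ℝ => -(z : ℂ)) k
      simp only [Complex.ofReal_mul, Complex.ofReal_div] at k'
      rw [ha, hr]
      simp only
      rw [e, posSqrt_ofReal, hx, hy]
      have e1 : ∀ z : ℝ, posSqrt (q * x * z) = (Real.sqrt (q * x * z) : ℂ) := fun z => by
        rw [← Complex.ofReal_mul, ← Complex.ofReal_mul, posSqrt_ofReal]
      rw [e1, e1, neg_div, k']
      ring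
  have hrt : Tendsto r (𝓝[S] γ) (𝓝[≠] 1) := by
    refine tendsto_nhdsWithin_iff.mpr ⟨?_, ?_⟩
    · have := hrc.tendsto.mono_left (nhdsWithin_le_nhds (s := S))
      rwa [hr1] at this
    · filter_upwards [self_mem_nhdsWithin] with d hd
      exact (hrS d hd).2.2.2.1
  have hslope := ((differentiableAt_confluentCore hq hγ ha0 (zeta_ne_zero hζp hζm s)
    (zeta_ne_zero hζp hζm t) one_ne_zero m).hasDerivAt.tendsto_slope).comp hrt
  -- What remains of the prefactor after `1 - r` is split off from `θ(γ/d) = (1 - r)(1 + r)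
  -- thetaReg(γ/d)`; it is continuous at `d = γ`.
  obtain ⟨H, hH⟩ : ∃ H : ℂ → ℂ, H = fun d => symbolFactor q ζp ζm γ d s t /
    (d * thetaReg q (γ / d) * (1 + r d) * qPoch q q ^ 2) := ⟨_, rfl⟩
  have hHc : ContinuousAt H γ := by
    rw [hH]
    have c1 : ContinuousAt (fun d => thetaReg q (γ / d)) γ := by
      refine ContinuousAt.comp' (g := thetaReg q) ?_ hdiv
      rw [div_self hγ]
      exact (differentiableAt_thetaReg hq one_ne_zero).continuousAt
    refine (continuousAt_symbolFactor hq hζp hζm h s t).div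
      (((continuousAt_id.mul c1).mul (continuousAt_const.add hrc)).mul continuousAt_const) ?_
    simp only [div_self hγ, hr1]
    have := thetaReg_one_ne_zero hq
    have h2 : (1 : ℂ) + 1 ≠ 0 := by norm_num
    positivity
  have hHγ : H γ = symbolFactor q ζp ζm γ γ s t / (2 * γ * qPoch q q ^ 4) := by
    rw [hH]
    simp only [div_self hγ, hr1, thetaReg_one]
    congr 1
    ring
  have hlim := (hHc.tendsto.mono_left (nhdsWithin_le_nhds (s := S))).mul hslope
  rw [hHγ] at hlim
  have hg : gauge s m * (gauge t 0)⁻¹ ≠ 0 :=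
    mul_ne_zero (gauge_ne_zero s m) (inv_ne_zero (gauge_ne_zero t 0))
  have hK : Tendsto (fun d => kernelOfNe q ζp ζm γ d (latticePoint q ζp ζm s m)
      (latticePoint q ζp ζm t 0)) (𝓝[S] γ)
      (𝓝 ((gauge s m * (gauge t 0)⁻¹)⁻¹ * (symbolFactor q ζp ζm γ γ s t /
        (2 * γ * qPoch q q ^ 4) *
        deriv (confluentCore q γ a (zeta ζp ζm s) (zeta ζp ζm t) m) 1))) := by
    refine (hlim.const_mul _).congr' ?_
    filter_upwards [self_mem_nhdsWithin] with d hd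
    obtain ⟨hd0, h2, hr0, hr1', hu⟩ := hrS d hd
    have hd' := hd
    rw [hS] at hd'
    rw [inv_mul_eq_iff_eq_mul₀ hg, gauged_kernelOfNe hq hζp hζm hd'.1,
      coreFactor_eq hq hγ hd0 hd'.2.symm, hu]
    have hv : -posSqrt (q * γ * d) / γ = a / r d := by
      have : -posSqrt (q * γ * d) / γ = -posSqrt (q * γ * d) / d * (d / γ) := by field_simp
      rw [this, hu, ← inv_div γ d, ← h2]
      field_simp
    have hd2 : d = γ / r d ^ 2 := by rw [h2, div_div_cancel₀ hγ]
    have hcc : core q γ d (a * r d) (a / r d) (zeta ζp ζm s) (zeta ζp ζm t) m =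
        confluentCore q γ a (zeta ζp ζm s) (zeta ζp ζm t) m (r d) := by
      rw [confluentCore, ← hd2]
    rw [hv, hcc, Function.comp, slope_def_field, confluentCore_one, sub_zero, hH,
      theta_eq_mul_thetaReg hq (γ / d)]
    simp only
    rw [← h2]
    have e : 1 - r d ^ 2 = -((r d - 1) * (1 + r d)) := by ring
    rw [e]
    generalize confluentCore q γ a (zeta ζp ζm s) (zeta ζp ζm t) m (r d) = c
    generalize thetaReg q (r d ^ 2) = c'
    generalize symbolFactor q ζp ζm γ d s t = c''
    simp only [div_eq_mul_inv, mul_inv, inv_neg]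
    ring
  have : (𝓝[S] γ).NeBot := by rw [hS]; exact neBot_admissible h
  rw [gaugedKernel, kernel, if_pos rfl, ← hS, hK.limUnder_eq, mul_inv_cancel_left₀ hg, ha]

lemma hasSum_gaugedKernel {q ζp ζm : ℝ} (hq : 0 < q ∧ q < 1) (hζp : 0 < ζp) (hζm : ζm < 0)
    {γ δ w : ℂ} (h : IsAdmissiblePair q ζp ζm γ δ) (hw : ‖w‖ = 1) (s t : Sgn) :
    HasSum (fun m : ℤ => w ^ m * gaugedKernel q ζp ζm γ δ s m t 0)
      (symbolFactor q ζp ζm γ δ s t *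
        (theta q (zeta ζp ζm s * (w * -posSqrt (q * γ * δ))) *
          theta q (zeta ζp ζm t * -posSqrt (q * γ * δ) / w) /
        (theta q (w * (-posSqrt (q * γ * δ) / δ)) * theta q (w * (-posSqrt (q * γ * δ) / γ))))) := by
  obtain ⟨⟨p, hp, hγδ⟩, hn1, hn2, hpos⟩ := h.facts hq hζp hζm
  have hγδ0 : γ * δ ≠ 0 := hγδ ▸ ofReal_ne_zero_of_pos hp
  have hγ : γ ≠ 0 := left_ne_zero_of_mul hγδ0
  have hδ : δ ≠ 0 := right_ne_zero_of_mul hγδ0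
  have hqq := qPoch_self_ne_zero hq
  have hτp : q * γ * δ = (q * p : ℝ) := by rw [mul_assoc, hγδ]; push_cast; rfl
  have hτ2 := posSqrt_sq (mul_pos hq.1 hp) hτp
  have hsδ : ∀ s, theta q (zeta ζp ζm s * δ) ≠ 0 := fun s => by
    obtain ⟨c, hc, hcθ⟩ := hpos s
    exact right_ne_zero_of_mul (hcθ ▸ ofReal_ne_zero_of_pos hc)
  have hst := theta_zeta_mul_inv_ne_zero hq hζp hζm s t
  have hzs := zeta_ne_zero hζp hζm s
  have hzt := zeta_ne_zero hζp hζm t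
  obtain ⟨τ, hτ⟩ : ∃ τ : ℂ, τ = -posSqrt (q * γ * δ) := ⟨_, rfl⟩
  have hττ : τ ^ 2 = q * γ * δ := by rw [hτ, neg_sq, hτ2]
  by_cases hne : γ = δ
  · subst hne
    have ha : (τ / γ) ^ 2 = (q : ℂ) := by rw [div_pow, hττ]; field_simp
    have hs := (hasSum_deriv_confluentCore hq hzs hzt hγ ha hw (hsδ t) (hsδ s) hst).mul_left
      (symbolFactor q ζp ζm γ γ s t / (2 * γ * qPoch q q ^ 4))
    simp only [gaugedKernel_confluent hq hζp hζm h, ← hτ]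
    convert! hs using 1
    · funext m
      ring
    · rw [mul_div_cancel₀ _ hγ]
      generalize theta q (w * (τ / γ)) = T
      generalize theta q (zeta ζp ζm t * τ / w) = T'
      field_simp
  · have hnγ := norm_pos_iff.mpr hγ
    have hnδ := norm_pos_iff.mpr hδ
    have hnτ : ‖τ‖ ^ 2 = q * ‖γ‖ * ‖δ‖ := by
      rw [← norm_pow, hττ, norm_mul, norm_mul, Complex.norm_real, Real.norm_of_nonneg hq.1.le]
    -- Since `|τ|² = q|a||b|`, one has `|τ/b|² = q|a|/|b|`, so the two norm inequalities of
    -- admissibility are the bounds `q < |τ/b| < 1`.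
    have bound : ∀ a b : ℂ, 0 < ‖a‖ → 0 < ‖b‖ → q * ‖b‖ < ‖a‖ → q * ‖a‖ < ‖b‖ →
        ‖τ‖ ^ 2 = q * ‖a‖ * ‖b‖ → q < ‖w * (τ / b)‖ ∧ ‖w * (τ / b)‖ < 1 := by
      intro a b ha hb h1 h2 h3
      rw [norm_mul, hw, one_mul, norm_div, lt_div_iff₀ hb, div_lt_one hb]
      constructor
      · refine lt_of_pow_lt_pow_left₀ 2 (norm_nonneg _) ?_
        rw [h3, mul_pow]
        have := mul_lt_mul_of_pos_left h1 (mul_pos hq.1 hb)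
        nlinarith
      · refine lt_of_pow_lt_pow_left₀ 2 hb.le ?_
        rw [h3]
        have := mul_lt_mul_of_pos_right h2 hb
        nlinarith
    obtain ⟨hu1, hu2⟩ := bound γ δ hnγ hnδ hn1 hn2 hnτ
    obtain ⟨hv1, hv2⟩ := bound δ γ hnδ hnγ hn2 hn1 (by rw [hnτ]; ring)
    have hs := (hasSum_core hq (w := w) (u := τ / δ) (v := τ / γ) hzs hzt hγ hδ
      (by rw [div_mul_div_comm, ← sq, hττ]; field_simp) (by field_simp)
      hu1 hu2 hv1 hv2 (hsδ t) (hsδ s) hst).mul_left (coreFactor q ζp ζm γ δ s t)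
    -- Admissibility gives `q < |γ/δ| < 1/q`, so the only possible zero is `γ/δ = 1`.
    have hθ : theta q (γ / δ) ≠ 0 := by
      rw [Ne, theta_eq_zero_iff hq (div_ne_zero hγ hδ)]
      rintro ⟨k, hk⟩
      have hnk : ‖γ‖ / ‖δ‖ = q ^ k := by rw [← norm_div, hk, norm_ofReal_zpow hq]
      have h1 : q ^ (1 : ℤ) < q ^ k := by
        rw [← hnk, zpow_one, lt_div_iff₀ hnδ]; exact hn1
      have h2 : q ^ k < q ^ (-1 : ℤ) := by
        rw [← hnk, zpow_neg_one, div_lt_iff₀ hnδ, ← div_eq_inv_mul, lt_div_iff₀ hq.1]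
        linarith
      have h3 := (zpow_lt_zpow_iff_right_of_lt_one₀ hq.1 hq.2).mp h1
      have h4 := (zpow_lt_zpow_iff_right_of_lt_one₀ hq.1 hq.2).mp h2
      have h5 : k = 0 := by omega
      rw [h5, zpow_zero, div_eq_one_iff_eq hδ] at hk
      exact hne hk
    convert! hs using 1
    · funext m
      have hk : gaugedKernel q ζp ζm γ δ s m t 0 = coreFactor q ζp ζm γ δ s t *
          core q γ δ (τ / δ) (τ / γ) (zeta ζp ζm s) (zeta ζp ζm t) m := by
        rw [gaugedKernel, kernel, if_neg hne, gauged_kernelOfNe hq hζp hζm h, hτ]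
      rw [hk]
      ring
    · rw [coreFactor_eq hq hγ hδ hne, coreSum, ← hτ, mul_div_cancel₀ _ hδ]
      generalize theta q (γ / δ) = T₀ at hθ ⊢
      generalize theta q (w * (τ / γ)) = T₁
      generalize theta q (w * (τ / δ)) = T₂
      generalize theta q (zeta ζp ζm t * τ / w) = T₃
      field_simp

/-- From `√(qγδ) = q √(γδ/q)`, each factor is shifted once by `q`; the two signs cancel and the
powers of `w` disappear from the prefactor. -/
lemma theta_mul_theta_shift {q : ℝ} (hq : 0 < q ∧ q < 1) {γ δ w x y : ℂ} {p : ℝ} (hp : 0 < p)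
    (h : γ * δ = p) (hw : w ≠ 0) (hx : x ≠ 0) (hy : y ≠ 0) :
    theta q (x * (w * -posSqrt (q * γ * δ))) * theta q (y * -posSqrt (q * γ * δ) / w) =
      q / (x * y * (γ * δ)) * (theta q (-(w * x * posSqrt (γ * δ / q))) *
        theta q (-(w⁻¹ * y * posSqrt (γ * δ / q)))) := by
  have hq' := ofReal_ne_zero_of_pos hq.1
  have h1 : γ * δ / q = (p / q : ℝ) := by rw [h]; push_cast; rfl
  have hpq : 0 < p / q := div_pos hp hq.1
  have hg0 := posSqrt_ne_zero hpq h1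
  have hg2 := posSqrt_sq hpq h1
  have hσ : posSqrt (q * γ * δ) = q * posSqrt (γ * δ / q) := by
    have h2 : (q : ℂ) * γ * δ = (q ^ 2 * (p / q) : ℝ) := by
      rw [mul_assoc, h]; push_cast; field_simp
    rw [h1, h2, posSqrt_ofReal, posSqrt_ofReal, Real.sqrt_mul (by positivity),
      Real.sqrt_sq hq.1.le]
    push_cast; rfl
  rw [hσ]
  generalize posSqrt (γ * δ / q) = g at hg0 hg2 ⊢
  have e1 : x * (w * -(q * g)) = q * (-(w * x * g)) := by ring
  have e2 : y * -(q * g) / w = q * (-(w⁻¹ * y * g)) := by field_simp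
  have n1 : -(w * x * g) ≠ 0 := neg_ne_zero.mpr (by positivity)
  have n2 : -(w⁻¹ * y * g) ≠ 0 := neg_ne_zero.mpr (by positivity)
  rw [e1, e2, theta_q_mul hq n1, theta_q_mul hq n2]
  have e3 : (-(w * x * g))⁻¹ * (-(w⁻¹ * y * g))⁻¹ = q / (x * y * (γ * δ)) := by
    have : γ * δ = q * g ^ 2 := by rw [hg2]; field_simp
    rw [this]
    field_simp
  linear_combination (theta q (-(w * x * g)) * theta q (-(w⁻¹ * y * g))) * e3

/-- The value of the Fourier transform before simplification of the prefactor. -/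
lemma hasSum_matrixKernel {q ζp ζm : ℝ} (hq : 0 < q ∧ q < 1) (hζp : 0 < ζp) (hζm : ζm < 0)
    {γ δ : ℂ} (h : IsAdmissiblePair q ζp ζm γ δ) (η : ℝ) (s t : Sgn) :
    HasSum (fun m : ℤ => Complex.exp (Complex.I * η * m) * matrixKernel q ζp ζm γ δ m 0 s t)
      (symbolFactor q ζp ζm γ δ s t * (q / (zeta ζp ζm s * zeta ζp ζm t * (γ * δ))) *
        (thetas q
            [-(Complex.exp (Complex.I * η) * zeta ζp ζm s * posSqrt (γ * δ / q)),
             -(Complex.exp (-(Complex.I * η)) * zeta ζp ζm t * posSqrt (γ * δ / q))] /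
          thetas q
            [-(Complex.exp (Complex.I * η) * posSqrt (q * γ * δ) / γ),
             -(Complex.exp (Complex.I * η) * posSqrt (q * γ * δ) / δ)])) := by
  obtain ⟨⟨p, hp, hγδ⟩, -, -, -⟩ := h.facts hq hζp hζm
  have hw : ‖Complex.exp (Complex.I * η)‖ = 1 := by
    rw [mul_comm]; exact Complex.norm_exp_ofReal_mul_I η
  have hs := hasSum_gaugedKernel hq hζp hζm h hw s t
  rw [theta_mul_theta_shift hq hp hγδ (Complex.exp_ne_zero _) (zeta_ne_zero hζp hζm s)
    (zeta_ne_zero hζp hζm t), ← Complex.exp_neg] at hs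
  convert! hs using 1
  · funext m
    rw [← Complex.exp_int_mul, mul_comm (m : ℂ)]
    rfl
  · simp only [thetas, List.map_cons, List.map_nil, List.prod_cons, List.prod_nil, mul_one]
    have e : ∀ a : ℂ, Complex.exp (Complex.I * η) * (-posSqrt (q * γ * δ) / a) =
      -(Complex.exp (Complex.I * η) * posSqrt (q * γ * δ) / a) := fun a => by ring
    rw [e, e]
    ring

/-- `symbolFactor` in terms of `A = √θ_q(γζ_+, δζ_+)` and `B = √θ_q(γζ_-, δζ_-)`. -/
lemma symbolFactor_eq {q ζp ζm : ℝ} (hq : 0 < q ∧ q < 1) (hζp : 0 < ζp) (hζm : ζm < 0)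
    {γ δ : ℂ} (h : IsAdmissiblePair q ζp ζm γ δ) :
    ∃ A B : ℂ, A ≠ 0 ∧ B ≠ 0 ∧
      thetas q [γ * ζp, δ * ζp] = A ^ 2 ∧ thetas q [γ * ζm, δ * ζm] = B ^ 2 ∧
      posSqrt (thetas q [γ * ζm, δ * ζm, γ * ζp, δ * ζp]) = A * B ∧
      ∀ s t : Sgn, symbolFactor q ζp ζm γ δ s t =
        A ^ 2 * B ^ 2 / (ζp * thetas q [(ζm : ℂ) / ζp, γ * δ * ζm * ζp]) *
          (Real.sqrt |zeta ζp ζm s| / Sgn.rec A B s) * (Real.sqrt |zeta ζp ζm t| / Sgn.rec A B t) := by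
  obtain ⟨-, -, -, hpos⟩ := h.facts hq hζp hζm
  obtain ⟨a, ha, haθ⟩ := hpos .plus
  obtain ⟨b, hb, hbθ⟩ := hpos .minus
  simp only [zeta] at haθ hbθ
  have hA : thetas q [γ * ζp, δ * ζp] = theta q (ζp * γ) * theta q (ζp * δ) := by
    simp only [thetas, List.map_cons, List.map_nil, List.prod_cons, List.prod_nil, mul_one]
    rw [mul_comm γ, mul_comm δ]
  have hB : thetas q [γ * ζm, δ * ζm] = theta q (ζm * γ) * theta q (ζm * δ) := by
    simp only [thetas, List.map_cons, List.map_nil, List.prod_cons, List.prod_nil, mul_one]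
    rw [mul_comm γ, mul_comm δ]
  have hAB : thetas q [γ * ζm, δ * ζm, γ * ζp, δ * ζp] = (a * b : ℝ) := by
    have : thetas q [γ * ζm, δ * ζm, γ * ζp, δ * ζp] =
        thetas q [γ * ζp, δ * ζp] * thetas q [γ * ζm, δ * ζm] := by
      simp only [thetas, List.map_cons, List.map_nil, List.prod_cons, List.prod_nil, mul_one]
      ring
    rw [this, hA, hB, haθ, hbθ]; push_cast; rfl
  refine ⟨posSqrt (theta q (ζp * γ) * theta q (ζp * δ)),
    posSqrt (theta q (ζm * γ) * theta q (ζm * δ)), posSqrt_ne_zero ha haθ, posSqrt_ne_zero hb hbθ,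
    ?_, ?_, ?_, fun s t => ?_⟩
  · rw [hA, posSqrt_sq ha haθ]
  · rw [hB, posSqrt_sq hb hbθ]
  · rw [hAB, haθ, hbθ, posSqrt_ofReal, posSqrt_ofReal, posSqrt_ofReal, Real.sqrt_mul ha.le]
    push_cast; rfl
  · have e : thetas q [γ * ζm, γ * ζp, δ * ζm, δ * ζp] =
        posSqrt (theta q (ζp * γ) * theta q (ζp * δ)) ^ 2 *
          posSqrt (theta q (ζm * γ) * theta q (ζm * δ)) ^ 2 := by
      rw [posSqrt_sq ha haθ, posSqrt_sq hb hbθ]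
      simp only [thetas, List.map_cons, List.map_nil, List.prod_cons, List.prod_nil, mul_one]
      rw [mul_comm γ, mul_comm γ, mul_comm δ, mul_comm δ]
      ring
    rw [symbolFactor, e]
    cases s <;> cases t <;> rfl

end EllipticTail

end

theorem proposition6p3 (q ζp ζm : ℝ) (hq0 : 0 < q) (hq1 : q < 1) (hζp : 0 < ζp) (hζm : ζm < 0)
    (γ δ : ℂ) (hadm : EllipticTail.IsAdmissiblePair q ζp ζm γ δ) (η : ℝ) :
    (∀ s t : EllipticTail.Sgn, Summable fun m : ℤ =>
      Complex.exp (Complex.I * η * m) * EllipticTail.matrixKernel q ζp ζm γ δ m 0 s t) ∧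
    EllipticTail.fourierSymbol q ζp ζm γ δ η .plus .plus =
      (q * EllipticTail.thetas q [γ * ζm, δ * ζm]) /
          (γ * δ * ζp ^ 2 * EllipticTail.thetas q [(ζm : ℂ) / ζp, γ * δ * ζm * ζp]) *
        (EllipticTail.thetas q
            [-(Complex.exp (Complex.I * η) * ζp * EllipticTail.posSqrt (γ * δ / q)),
             -(Complex.exp (-(Complex.I * η)) * ζp * EllipticTail.posSqrt (γ * δ / q))] /
          EllipticTail.thetas q
            [-(Complex.exp (Complex.I * η) * EllipticTail.posSqrt (q * γ * δ) / γ),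
             -(Complex.exp (Complex.I * η) * EllipticTail.posSqrt (q * γ * δ) / δ)]) ∧
    EllipticTail.fourierSymbol q ζp ζm γ δ η .plus .minus =
      -((q * EllipticTail.posSqrt (EllipticTail.thetas q [γ * ζm, δ * ζm, γ * ζp, δ * ζp])) /
          (γ * δ * ζp * (Real.sqrt |ζm * ζp| : ℂ) *
            EllipticTail.thetas q [(ζm : ℂ) / ζp, γ * δ * ζm * ζp])) *
        (EllipticTail.thetas q
            [-(Complex.exp (Complex.I * η) * ζp * EllipticTail.posSqrt (γ * δ / q)),
             -(Complex.exp (-(Complex.I * η)) * ζm * EllipticTail.posSqrt (γ * δ / q))] /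
          EllipticTail.thetas q
            [-(Complex.exp (Complex.I * η) * EllipticTail.posSqrt (q * γ * δ) / γ),
             -(Complex.exp (Complex.I * η) * EllipticTail.posSqrt (q * γ * δ) / δ)]) ∧
    EllipticTail.fourierSymbol q ζp ζm γ δ η .minus .plus =
      -((q * EllipticTail.posSqrt (EllipticTail.thetas q [γ * ζm, δ * ζm, γ * ζp, δ * ζp])) /
          (γ * δ * ζp * (Real.sqrt |ζm * ζp| : ℂ) *
            EllipticTail.thetas q [(ζm : ℂ) / ζp, γ * δ * ζm * ζp])) *
        (EllipticTail.thetas q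
            [-(Complex.exp (Complex.I * η) * ζm * EllipticTail.posSqrt (γ * δ / q)),
             -(Complex.exp (-(Complex.I * η)) * ζp * EllipticTail.posSqrt (γ * δ / q))] /
          EllipticTail.thetas q
            [-(Complex.exp (Complex.I * η) * EllipticTail.posSqrt (q * γ * δ) / γ),
             -(Complex.exp (Complex.I * η) * EllipticTail.posSqrt (q * γ * δ) / δ)]) ∧
    EllipticTail.fourierSymbol q ζp ζm γ δ η .minus .minus =
      (q * EllipticTail.thetas q [γ * ζp, δ * ζp]) /
          (γ * δ * (|ζm * ζp| : ℝ) *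
            EllipticTail.thetas q [(ζm : ℂ) / ζp, γ * δ * ζm * ζp]) *
        (EllipticTail.thetas q
            [-(Complex.exp (Complex.I * η) * ζm * EllipticTail.posSqrt (γ * δ / q)),
             -(Complex.exp (-(Complex.I * η)) * ζm * EllipticTail.posSqrt (γ * δ / q))] /
          EllipticTail.thetas q
            [-(Complex.exp (Complex.I * η) * EllipticTail.posSqrt (q * γ * δ) / γ),
             -(Complex.exp (Complex.I * η) * EllipticTail.posSqrt (q * γ * δ) / δ)]) := by
  have hq : 0 < q ∧ q < 1 := ⟨hq0, hq1⟩
  have hsum := EllipticTail.hasSum_matrixKernel hq hζp hζm hadm η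
  obtain ⟨⟨p, hp, hγδ⟩, -, -, -⟩ := hadm.facts hq hζp hζm
  have hγδ0 : γ * δ ≠ 0 := hγδ ▸ EllipticTail.ofReal_ne_zero_of_pos hp
  have hγ : γ ≠ 0 := left_ne_zero_of_mul hγδ0
  have hδ : δ ≠ 0 := right_ne_zero_of_mul hγδ0
  obtain ⟨A, B, hA, hB, hA2, hB2, hAB, hfac⟩ := EllipticTail.symbolFactor_eq hq hζp hζm hadm
  have hp' := EllipticTail.ofReal_ne_zero_of_pos hζp
  have hm' : (ζm : ℂ) ≠ 0 := by exact_mod_cast hζm.ne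
  obtain ⟨t1, -, t3⟩ := EllipticTail.theta_denominators_ne_zero hq hζp hζm hp hγδ
  have hT : EllipticTail.thetas q [(ζm : ℂ) / ζp, γ * δ * ζm * ζp] ≠ 0 := by
    simpa [EllipticTail.thetas] using And.intro t1 t3
  have hsq : ∀ x : ℝ, (Real.sqrt |x| : ℂ) ^ 2 = (|x| : ℝ) := fun x => by
    rw [← Complex.ofReal_pow, Real.sq_sqrt (abs_nonneg _)]
  have hap : ((|ζp| : ℝ) : ℂ) = ζp := by rw [abs_of_pos hζp]
  -- This sign produces the minus in the two off-diagonal entries: the prefactor carries `1/(ζ_s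
  -- ζ_t)`, while the square roots contribute absolute values.
  have ham : ((|ζm| : ℝ) : ℂ) = -ζm := by rw [abs_of_neg hζm]; push_cast; rfl
  have hamp : ((|ζm * ζp| : ℝ) : ℂ) = -ζm * ζp := by rw [abs_mul]; push_cast; rw [hap, ham]
  have hsp := hsq ζp
  have hsm := hsq ζm
  rw [hap] at hsp
  rw [ham] at hsm
  have hsmp : (Real.sqrt |ζm * ζp| : ℂ) = Real.sqrt |ζm| * Real.sqrt |ζp| := by
    rw [abs_mul, Real.sqrt_mul (abs_nonneg _)]; push_cast; rfl
  have hsp0 : (Real.sqrt |ζp| : ℂ) ≠ 0 := by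
    intro h0; rw [h0] at hsp; exact hp' (by rw [← hsp]; ring)
  have hsm0 : (Real.sqrt |ζm| : ℂ) ≠ 0 := by
    intro h0; rw [h0] at hsm; exact hm' (by linear_combination hsm)
  refine ⟨fun s t => (hsum s t).summable, ?_, ?_, ?_, ?_⟩
  · refine (hsum .plus .plus).tsum_eq.trans ?_
    rw [hfac, hB2]
    simp only [EllipticTail.zeta]
    congr 1
    generalize EllipticTail.thetas q [(ζm : ℂ) / ζp, γ * δ * ζm * ζp] = T at hT ⊢
    field_simp
    rw [hsp]
  · refine (hsum .plus .minus).tsum_eq.trans ?_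
    rw [hfac, hAB, hsmp]
    simp only [EllipticTail.zeta]
    congr 1
    generalize EllipticTail.thetas q [(ζm : ℂ) / ζp, γ * δ * ζm * ζp] = T at hT ⊢
    generalize (Real.sqrt |ζp| : ℂ) = P at hsp hsp0 ⊢
    generalize (Real.sqrt |ζm| : ℂ) = M at hsm hsm0 ⊢
    field_simp
    rw [hsp, hsm]
    ring
  · refine (hsum .minus .plus).tsum_eq.trans ?_
    rw [hfac, hAB, hsmp]
    simp only [EllipticTail.zeta]
    congr 1
    generalize EllipticTail.thetas q [(ζm : ℂ) / ζp, γ * δ * ζm * ζp] = T at hT ⊢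
    generalize (Real.sqrt |ζp| : ℂ) = P at hsp hsp0 ⊢
    generalize (Real.sqrt |ζm| : ℂ) = M at hsm hsm0 ⊢
    field_simp
    rw [hsp, hsm]
    ring
  · refine (hsum .minus .minus).tsum_eq.trans ?_
    rw [hfac, hA2, hamp]
    simp only [EllipticTail.zeta]
    congr 1
    generalize EllipticTail.thetas q [(ζm : ℂ) / ζp, γ * δ * ζm * ζp] = T at hT ⊢
    generalize (Real.sqrt |ζm| : ℂ) = M at hsm hsm0 ⊢
    field_simp
    rw [hsm]
    ring
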